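/- For $n\ge 1$, $s\ge 1$, $f:[0,1]\to\mathbb{R}$ and $x\in[0,1]$ let $$S_{n,s}f(x)=\frac{\sum_{k=0}^n f(k/n)\,|x-k/n|^{-s}}{\sum_{k=0}^n |x-k/n|^{-s}}$$ if $x$ is not one of the nodes $k/n$, $0\le k\le n$, and $S_{n,s}f(x)=f(x)$ if $x$ is a node (Shepard operators). For $x_0\in[0,1]$ and $d\in\mathbb{R}$ let $h$ be the step function with $h(x)=1$ for $x<x_0$, $h(x_0)=d$ and $h(x)=0$ for $x>x_0$. For $K\subseteq\mathbb{N}$ let $\delta_-(K)$ and $\delta_+(K)$ be the lower and upper limits of $|K\cap\{1,\dots,n\}|/n$ as $n\to\infty$; $K$ has density $\delta$ if both equal $\delta$. For a real sequence $(x_n)_{n\ge1}$, a real number $L$ and a set $A\subseteq\mathbb{R}$ define the indices of convergence $$i(x_n;L)=1-\sup_{\varepsilon>0}\delta_+(\{n: |x_n-L|\ge\varepsilon\}),\qquad i(x_n;A)=1-\sup_{\varepsilon>0}\delta_+(\{n: x_n\notin A+\left]-\varepsilon,\varepsilon\right[\}).$$ For $s>1$ and $0<x<1$ let $g_s(x)=\dfrac{\zeta(s,x)}{\zeta(s,x)+\zeta(s,1-x)}$,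 where $\zeta(s,a)=\sum_{n=0}^\infty (n+a)^{-s}$ is the Hurwitz zeta function, and let $g_s(0)=1$, $g_s(1)=0$ (the limit values), so that $g_s:[0,1]\to\mathbb{R}$. **Theorem 3.1.** Let $s\ge1$, $x_0\in[0,1]$, $d\in\mathbb{R}$. Then $S_{n,s}h\to h$ uniformly on every compact subset of $[0,1]\setminus\{x_0\}$. Moreover: (i) Let $x_0=p/q$ with $p,q\in\mathbb{N}$, $q\ne0$, $\gcd(p,q)=1$. If $s>1$, then $i(S_{n,s}h(x_0);d)=\frac1q$ provided that $d\ne g_s(m/q)$ for all $m=1,\dots,q-1$; and, for each $m=1,\dots,q-1$ with $g_s(m/q)\neq d$, $i\big(S_{n,s}h(x_0);g_s(m/q)\big)=\frac1q$. If $s=1$, then $i(S_{n,1}h(x_0);d)=\frac1q$ provided that $d\ne\frac12$ or $q=1$; and $i(S_{n,1}h(x_0);\frac12)=1-\frac1q$ provided that $d\neq\frac12$. (ii) Let $x_0$ be irrational. If $s>1$, then for every Peano–Jordan measurable $A\subset\mathbb{R}$ (that is, $A$ is bounded with boundary of measure zero) the set $g_s^{-1}(A)$ is Peano–Jordan measurable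 and $i(S_{n,s}h(x_0);A)=|g_s^{-1}(A)|$, where $|\cdot|$ is the Peano–Jordan measure. If $s=1$, then $i(S_{n,1}h(x_0);\frac12)=1$. Moreover there are subsequences of $(S_{n,1}h(x_0))_{n\ge1}$ converging to $0$ and subsequences converging to $1$, and for every such subsequence the set of its indices $n$ has density zero. -/

import Mathlib

open Set Filter Topology MeasureTheory
open scoped Pointwise

noncomputable section

namespace ShepardIndex

/-- The proportion `|K ∩ {1, …, n}| / n`. -/
def proportion (K : Set ℕ) (n : ℕ) : ℝ :=
  ((K ∩ Set.Icc 1 n).ncard : ℝ) / (n : ℝ)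

/-- The lower density of a set of natural numbers. -/
def lowerDensity (K : Set ℕ) : ℝ :=
  Filter.liminf (fun n : ℕ => proportion K n) atTop

/-- The upper density of a set of natural numbers. -/
def upperDensity (K : Set ℕ) : ℝ :=
  Filter.limsup (fun n : ℕ => proportion K n) atTop

/-- `K` has density `δ`: its lower and upper densities both equal `δ`. -/
def HasDensity (K : Set ℕ) (δ : ℝ) : Prop :=
  lowerDensity K = δ ∧ upperDensity K = δ

/-- The index of convergence of a real sequence `(x n)`, `n ≥ 1`, to a real number `L`. The term
`x 0` plays no role, because densities only see the integers `n ≥ 1`. -/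
def index (x : ℕ → ℝ) (L : ℝ) : ℝ :=
  1 - ⨆ ε : {ε : ℝ // 0 < ε},
    upperDensity {n : ℕ | x n ∈ Set.Iic (L - (ε : ℝ)) ∪ Set.Ici (L + (ε : ℝ))}

/-- The index of convergence of a real sequence relative to a set `A ⊆ ℝ`; here
`A + Ioo (-ε) ε` is the Minkowski sum. -/
def setIndex (x : ℕ → ℝ) (A : Set ℝ) : ℝ :=
  1 - ⨆ ε : {ε : ℝ // 0 < ε},
    upperDensity {n : ℕ | x n ∉ A + Set.Ioo (-(ε : ℝ)) (ε : ℝ)}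

/-- Peano-Jordan measurability of a set of real numbers: the set is bounded and its boundary is
null. The Peano-Jordan measure of such a set is its Lebesgue measure. -/
def IsJordanMeasurable (A : Set ℝ) : Prop :=
  Bornology.IsBounded A ∧ volume (frontier A) = 0

open Classical in
/-- The `n`-th Shepard operator (`n ≥ 1`) with exponent `s`, at the nodes `k / n`, `0 ≤ k ≤ n`.
At a node, where the weight `|x - k / n| ^ (-s)` is infinite, the value is the interpolated one. -/
def shepard (n : ℕ) (s : ℝ) (f : ℝ → ℝ) (x : ℝ) : ℝ :=
  if ∃ k ∈ Finset.range (n + 1), x = (k : ℝ) / (n : ℝ) then f x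
  else
    (∑ k ∈ Finset.range (n + 1), f ((k : ℝ) / (n : ℝ)) * |x - (k : ℝ) / (n : ℝ)| ^ (-s)) /
      (∑ k ∈ Finset.range (n + 1), |x - (k : ℝ) / (n : ℝ)| ^ (-s))

/-- The step function equal to `1` to the left of `x₀`, to `d` at `x₀` and to `0` to the right. -/
def step (x₀ d : ℝ) (x : ℝ) : ℝ :=
  if x < x₀ then 1 else if x = x₀ then d else 0

/-- The Hurwitz zeta function at real arguments `s > 1`, `a > 0`, where the series converges. -/
def hurwitz (s a : ℝ) : ℝ :=
  ∑' n : ℕ, 1 / ((n : ℝ) + a) ^ s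

/-- `g s x = ζ(s, x) / (ζ(s, x) + ζ(s, 1 - x))` for `0 < x < 1`. At the end points, where one of
the two zeta values is infinite, the function takes its limit values `1` at `0` and `0` at `1`. -/
def g (s x : ℝ) : ℝ :=
  if x = 0 then 1
  else if x = 1 then 0
  else hurwitz s x / (hurwitz s x + hurwitz s (1 - x))

/-- The preimage of `A` under `g s : [0, 1] → ℝ`. -/
def gPreimage (s : ℝ) (A : Set ℝ) : Set ℝ :=
  {x : ℝ | x ∈ Set.Icc (0 : ℝ) 1 ∧ g s x ∈ A}

end ShepardIndex

end

open ShepardIndex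

namespace ShepardIndex

/-! Let `f` be the fractional part of `n * x₀`. If `f ≠ 0`, the nodes to the left of `x₀` lie at
distances `(j + f) / n` and those to the right at `(j + 1 - f) / n`. The powers of `n` cancel, and
the operator at the jump is `A / (A + B)` with `A`, `B` partial sums of `ζ(s, f)` and `ζ(s, 1 - f)`
(`shepard_step_eq`). If `f = 0`, the value is `d`. For `0 < x₀ < 1` both sums lengthen without
bound. When `s > 1` the tails are uniformly small, so the value is asymptotic to `g s f`
(`eventually_abs_shepard_sub_g_le`). When `s = 1` both sums grow like `log n`, so the value tends to
`1 / 2` while `f` keeps away from `0` and `1`.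

For `x₀ = p / q` the number `f` is determined by `n * p` modulo `q`, each residue class has density
`1 / q`, and `g s` is injective on `(0, 1)`; the indices are then densities of unions of residue
classes (`index_eq_of_finite_values`).

For irrational `x₀` the numbers `f` are equidistributed (Weyl). A lower bound for the frequency of
visits to open sets suffices (`eventually_lt_proportion_fract`): it is applied to the preimages of
the interior of `A` and of the complement of a thickening of `A`. Nothing is lost at the boundary,
because `g s` has a locally Lipschitz inverse and so pulls null sets back to null sets. If `s = 1`,
exceptional `n` have `f` close to `0` or `1` and hence density zero; they occur infinitely often by
one-sided Dirichlet approximation, where `f < 1 / n` gives `A ≥ n` against `B = O(log n)`.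

Away from the jump, nodes closer than `δ` contribute no error, the others contribute `O(n)`, and the
total weight is at least `n * log (n + 1)`. -/

/-! ### Proportions and densities of sets of natural numbers. -/

theorem proportion_nonneg (K : Set ℕ) (N : ℕ) : 0 ≤ proportion K N := by
  unfold proportion; positivity

theorem finite_inter_Icc (K : Set ℕ) (N : ℕ) : (K ∩ Icc 1 N).Finite :=
  (finite_Icc 1 N).inter_of_right K

theorem ncard_Icc_one (N : ℕ) : (Icc 1 N : Set ℕ).ncard = N := by
  rw [← Finset.coe_Icc, ncard_coe_finset]; simp

theorem proportion_mono {K L : Set ℕ} (h : K ⊆ L) (N : ℕ) :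
    proportion K N ≤ proportion L N := by
  unfold proportion
  gcongr
  exact finite_inter_Icc L N

theorem proportion_le_one (K : Set ℕ) (N : ℕ) : proportion K N ≤ 1 := by
  unfold proportion
  apply div_le_one_of_le₀ _ (Nat.cast_nonneg N)
  have := ncard_le_ncard (inter_subset_right : K ∩ Icc 1 N ⊆ Icc 1 N) (finite_Icc 1 N)
  rw [ncard_Icc_one] at this
  exact_mod_cast this

/-- At `N = 0` both proportions are `0 / 0 = 0`, hence the exclusion. -/
theorem proportion_compl (K : Set ℕ) {N : ℕ} (hN : N ≠ 0) :
    proportion Kᶜ N = 1 - proportion K N := by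
  have h : (Kᶜ ∩ Icc 1 N).ncard + (K ∩ Icc 1 N).ncard = N := by
    rw [← ncard_union_eq _ (finite_inter_Icc _ _) (finite_inter_Icc _ _), ← union_inter_distrib_right,
      compl_union_self, univ_inter, ncard_Icc_one]
    exact disjoint_compl_left.mono inter_subset_left inter_subset_left
  unfold proportion
  have hN' : (N : ℝ) ≠ 0 := Nat.cast_ne_zero.2 hN
  field_simp
  rw [eq_sub_iff_add_eq]
  exact_mod_cast h

theorem tendsto_proportion_compl {K : Set ℕ} {ρ : ℝ} (h : Tendsto (proportion K) atTop (𝓝 ρ)) :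
    Tendsto (proportion Kᶜ) atTop (𝓝 (1 - ρ)) := by
  refine (h.const_sub 1).congr' ?_
  filter_upwards [eventually_ne_atTop 0] with N hN
  exact (proportion_compl _ hN).symm

theorem proportion_union_le (K L : Set ℕ) (N : ℕ) :
    proportion (K ∪ L) N ≤ proportion K N + proportion L N := by
  unfold proportion
  rw [← add_div, union_inter_distrib_right]
  gcongr
  exact_mod_cast ncard_union_le _ _

theorem tendsto_proportion_of_finite {K : Set ℕ} (hK : K.Finite) :
    Tendsto (proportion K) atTop (𝓝 0) := by
  refine squeeze_zero (proportion_nonneg K) (fun N => ?_)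
    (tendsto_const_div_atTop_nhds_zero_nat (K.ncard : ℝ))
  unfold proportion
  gcongr
  exact inter_subset_left

/-- A set eventually contained in another one has asymptotically at most its proportion. -/
theorem proportion_le_add_of_eventually {K L : Set ℕ} (h : ∀ᶠ n in atTop, n ∈ K → n ∈ L)
    {η : ℝ} (hη : 0 < η) : ∀ᶠ N in atTop, proportion K N ≤ proportion L N + η := by
  obtain ⟨a, ha⟩ := eventually_atTop.1 h
  filter_upwards [(tendsto_proportion_of_finite (finite_lt_nat a)).eventually_le_const hη] with N hN
  have hsub : K ⊆ L ∪ {n | n < a} := fun n hn => by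
    rcases lt_or_ge n a with h' | h'
    · exact Or.inr h'
    · exact Or.inl (ha n h' hn)
  linarith [proportion_mono hsub N, proportion_union_le L {n | n < a} N]

theorem isBoundedUnder_le_proportion (K : Set ℕ) :
    IsBoundedUnder (· ≤ ·) atTop (proportion K) :=
  isBoundedUnder_of ⟨1, proportion_le_one K⟩

theorem isBoundedUnder_ge_proportion (K : Set ℕ) :
    IsBoundedUnder (· ≥ ·) atTop (proportion K) :=
  isBoundedUnder_of ⟨0, proportion_nonneg K⟩

theorem upperDensity_le {K : Set ℕ} {c : ℝ}
    (h : ∀ η > 0, ∀ᶠ N in atTop, proportion K N ≤ c + η) : upperDensity K ≤ c := by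
  refine le_of_forall_pos_le_add fun η hη => ?_
  exact limsup_le_of_le (isBoundedUnder_ge_proportion K).isCoboundedUnder_le (h η hη)

theorem le_upperDensity {K : Set ℕ} {c : ℝ}
    (h : ∀ᶠ N in atTop, c ≤ proportion K N) : c ≤ upperDensity K :=
  le_limsup_of_frequently_le h.frequently (isBoundedUnder_le_proportion K)

theorem hasDensity_of_tendsto {K : Set ℕ} {c : ℝ} (h : Tendsto (proportion K) atTop (𝓝 c)) :
    HasDensity K c :=
  ⟨h.liminf_eq, h.limsup_eq⟩

/-! ### Computing indices of convergence. -/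

theorem iSup_pos_eq {u : {ε : ℝ // 0 < ε} → ℝ} {c : ℝ} (hle : ∀ ε, u ε ≤ c)
    (hge : ∀ η > 0, ∃ ε, c - η ≤ u ε) : ⨆ ε, u ε = c := by
  have : Nonempty {ε : ℝ // 0 < ε} := ⟨⟨1, one_pos⟩⟩
  refine le_antisymm (ciSup_le hle) (le_of_forall_pos_le_add fun η hη => ?_)
  obtain ⟨ε, hε⟩ := hge η hη
  linarith [le_ciSup ⟨c, forall_mem_range.2 hle⟩ ε]

theorem mem_Iic_union_Ici_iff {x L ε : ℝ} :
    x ∈ Iic (L - ε) ∪ Ici (L + ε) ↔ ε ≤ |x - L| := by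
  rw [le_abs, mem_union, mem_Iic, mem_Ici]
  constructor <;> rintro (h | h)
  · right; linarith
  · left; linarith
  · right; linarith
  · left; linarith

/-- A sequence asymptotic to a sequence `y` with finitely many values has, at each `L`, the density
of `{n | y n = L}` as its index of convergence. -/
theorem index_eq_of_finite_values {x y : ℕ → ℝ} {V : Set ℝ} (hV : V.Finite) (hy : ∀ n, y n ∈ V)
    (hxy : Tendsto (fun n => x n - y n) atTop (𝓝 0)) {L ρ : ℝ}
    (hρ : Tendsto (proportion {n | y n = L}) atTop (𝓝 ρ)) : index x L = ρ := by
  have hclose : ∀ δ > 0, ∀ᶠ n in atTop, |x n - y n| < δ := fun δ hδ => by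
    simpa [Real.dist_eq] using (Metric.tendsto_nhds.1 hxy δ hδ)
  have hcompl := tendsto_proportion_compl hρ
  unfold index
  simp only [mem_Iic_union_Ici_iff]
  rw [iSup_pos_eq (c := 1 - ρ)]
  · ring
  · rintro ⟨ε, hε⟩
    refine upperDensity_le fun η hη => ?_
    have h1 : ∀ᶠ n in atTop, n ∈ {n | ε ≤ |x n - L|} → n ∈ {n | y n = L}ᶜ := by
      filter_upwards [hclose ε hε] with n hn hn' (h : y n = L)
      rw [h] at hn
      exact absurd hn' (not_le.2 hn)
    filter_upwards [proportion_le_add_of_eventually h1 (half_pos hη),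
      hcompl.eventually_lt_const (show 1 - ρ < 1 - ρ + η / 2 by linarith)] with N h2 h3
    linarith
  · intro η hη
    -- Finitely many values are uniformly separated from `L`; the gap `2 * δ` leaves room for an
    -- error `δ` between `x` and `y`.
    obtain ⟨δ, hδ, hsep⟩ : ∃ δ > 0, ∀ v ∈ V, v ≠ L → 2 * δ ≤ |v - L| := by
      have hev : ∀ v ∈ V, ∀ᶠ δ in 𝓝[>] (0 : ℝ), v ≠ L → 2 * δ ≤ |v - L| := by
        intro v _
        by_cases hvL : v = L
        · simp [hvL]
        have hpos : 0 < |v - L| / 2 := half_pos (abs_pos.2 (sub_ne_zero.2 hvL))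
        filter_upwards [Ioo_mem_nhdsGT hpos] with δ hδ _
        linarith [hδ.2]
      obtain ⟨δ, h1, h2⟩ := (((hV.eventually_all).2 hev).and self_mem_nhdsWithin).exists
      exact ⟨δ, h2, h1⟩
    refine ⟨⟨δ, hδ⟩, le_upperDensity ?_⟩
    have h1 : ∀ᶠ n in atTop, n ∈ {n | y n = L}ᶜ → n ∈ {n | δ ≤ |x n - L|} := by
      filter_upwards [hclose δ hδ] with n hn (hn' : y n ≠ L)
      have := hsep _ (hy n) hn'
      have h3 := abs_sub_le (y n) (x n) L
      rw [abs_sub_comm (y n) (x n)] at h3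
      change δ ≤ |x n - L|
      linarith
    filter_upwards [proportion_le_add_of_eventually h1 (half_pos hη),
      hcompl.eventually_const_lt (show 1 - ρ - η / 2 < 1 - ρ by linarith)] with N h2 h3
    linarith

/-! ### Density of residue classes. -/

/-- A residue class modulo `q` has density `1 / q`. -/
theorem tendsto_proportion_mul_mod {p q m : ℕ} (hpq : p.Coprime q) (hm : m < q) :
    Tendsto (proportion {n | n * p % q = m}) atTop (𝓝 (1 / (q : ℝ))) := by
  have hq : 0 < q := by omega
  have hq' : (0 : ℝ) < q := by exact_mod_cast hq
  -- Multiplication by the inverse `c` of `p` modulo `q` turns the condition into `n ≡ m * c`. The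
  -- modulus `1` is treated apart, since no product has remainder `1` there.
  have hclass : ∃ r : ℕ, {n | n * p % q = m} = {n | n ≡ r [MOD q]} := by
    by_cases hq1 : q = 1
    · subst hq1
      refine ⟨0, ?_⟩
      ext n
      simp [Nat.mod_one, Nat.modEq_one]
      omega
    obtain ⟨c, -, hc⟩ := Nat.exists_mul_mod_eq_one_of_coprime hpq (by omega)
    have hc' : c * p ≡ 1 [MOD q] := by
      rw [Nat.ModEq, mul_comm, hc, Nat.mod_eq_of_lt (by omega)]
    refine ⟨m * c, ext fun n => ?_⟩
    have hmc : m * c * p ≡ m [MOD q] := by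
      simpa [mul_assoc] using (Nat.ModEq.refl m).mul hc'
    constructor
    · intro (h : n * p % q = m)
      have h1 : n * p ≡ m * c * p [MOD q] := by
        rw [Nat.ModEq, h, hmc, Nat.mod_eq_of_lt hm]
      exact Nat.ModEq.cancel_right_of_coprime (by rwa [Nat.gcd_comm]) h1
    · intro h
      have h1 := (Nat.ModEq.mul_right p h).trans hmc
      rwa [Nat.ModEq, Nat.mod_eq_of_lt hm] at h1
  obtain ⟨r, hr⟩ := hclass
  rw [hr]
  have hcount : ∀ᶠ N : ℕ in atTop, ‖proportion {n | n ≡ r [MOD q]} N - 1 / q‖ ≤ 1 / N := by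
    filter_upwards [eventually_gt_atTop 0] with N hN
    have hN' : (0 : ℝ) < N := by exact_mod_cast hN
    have hset : ({n | n ≡ r [MOD q]} ∩ Icc 1 N).ncard =
        ({n ∈ Finset.Ioc 0 N | n ≡ r [MOD q]}).card := by
      rw [← ncard_coe_finset]
      congr 1
      ext n
      simp [Nat.succ_le_iff, and_comm]
    have hcard := Nat.Ioc_filter_modEq_card 0 N hq r
    rw [← hset] at hcard
    set k := ({n | n ≡ r [MOD q]} ∩ Icc 1 N).ncard with hk
    have hbound : |(k : ℚ) - N / q| ≤ 1 := by
      have h1 := Int.floor_le (((N : ℚ) - r) / q)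
      have h2 := Int.lt_floor_add_one (((N : ℚ) - r) / q)
      have h3 := Int.floor_le ((((0 : ℕ) : ℚ) - r) / q)
      have h4 := Int.lt_floor_add_one ((((0 : ℕ) : ℚ) - r) / q)
      have h5 : (0 : ℚ) ≤ N / q := by positivity
      have hcardQ : (k : ℚ) = max ((⌊((N : ℚ) - r) / q⌋ : ℚ) - ⌊(((0 : ℕ) : ℚ) - r) / q⌋) 0 := by
        exact_mod_cast hcard
      rw [sub_div] at h1 h2 h3 h4 hcardQ
      simp only [Nat.cast_zero, zero_div, sub_div] at h3 h4 hcardQ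
      rw [hcardQ, abs_le]
      constructor
      · linarith [le_max_left ((⌊(N : ℚ) / q - r / q⌋ : ℚ) - ⌊(0 : ℚ) - r / q⌋) 0]
      · rw [sub_le_iff_le_add, max_le_iff]
        constructor <;> linarith
    have hboundR : |(k : ℝ) - N / q| ≤ 1 := by
      have := (Rat.cast_le (K := ℝ)).2 hbound
      push_cast at this
      exact this
    unfold proportion
    rw [← hk, Real.norm_eq_abs, show (k : ℝ) / N - 1 / q = (k - N / q) / N by field_simp,
      abs_div, abs_of_pos hN']
    gcongr
  rw [tendsto_iff_norm_sub_tendsto_zero]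
  exact squeeze_zero' (Eventually.of_forall fun _ => norm_nonneg _) hcount
    (tendsto_const_div_atTop_nhds_zero_nat (1 : ℝ))

/-! ### Equidistribution of the multiples of an irrational number. -/

/-- Weyl's equidistribution theorem for the Fourier monomials. -/
theorem tendsto_average_fourier {x : ℝ} (hx : Irrational x) (k : ℤ) :
    Tendsto (fun N : ℕ => (N : ℂ)⁻¹ * ∑ n ∈ Finset.Icc 1 N,
        fourier k (((n * x : ℝ)) : AddCircle (1 : ℝ)))
      atTop (𝓝 (∫ t : AddCircle (1 : ℝ), fourier k t)) := by
  by_cases hk : k = 0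
  · subst hk
    simp only [fourier_zero, Finset.sum_const, Nat.card_Icc, add_tsub_cancel_right, nsmul_eq_mul,
      mul_one, integral_const, measureReal_def, AddCircle.measure_univ]
    simp only [ENNReal.ofReal_one, ENNReal.toReal_one, one_smul]
    refine tendsto_const_nhds.congr' ?_
    filter_upwards [eventually_ne_atTop 0] with N hN
    rw [inv_mul_cancel₀ (Nat.cast_ne_zero.2 hN)]
  have hint : ∫ t : AddCircle (1 : ℝ), fourier k t = 0 := by
    have h := fourierCoeff_fourier (T := 1) k
    have h0 := congrFun h 0
    rw [fourierCoeff] at h0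
    simpa [AddCircle.integral_haarAddCircle, hk, Pi.single_apply, eq_comm] using h0
  rw [hint]
  set z : ℂ := fourier k ((x : ℝ) : AddCircle (1 : ℝ)) with hz
  have hpow (n : ℕ) : fourier k (((n * x : ℝ)) : AddCircle (1 : ℝ)) = z ^ n := by
    rw [hz, fourier_coe_apply, fourier_coe_apply, ← Complex.exp_nat_mul]
    congr 1
    push_cast
    ring
  have hz1 : z ≠ 1 := by
    rw [hz, fourier_coe_apply, Ne, Complex.exp_eq_one_iff]
    rintro ⟨m, hm⟩
    have hpi : (2 * Real.pi * Complex.I : ℂ) ≠ 0 := Complex.two_pi_I_ne_zero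
    have h1 : ((k : ℂ) * x - m) * (2 * Real.pi * Complex.I) = 0 := by
      have : (2 * Real.pi * Complex.I * k * x / (1 : ℝ) : ℂ) = m * (2 * Real.pi * Complex.I) := hm
      rw [Complex.ofReal_one, div_one] at this
      linear_combination this
    have h2 : (k : ℝ) * x = m := by
      have := sub_eq_zero.1 ((mul_eq_zero.1 h1).resolve_right hpi)
      exact_mod_cast this
    exact (hx.intCast_mul hk).ne_int m h2
  have hznorm : ‖z‖ = 1 := by
    rw [hz, fourier_apply]
    exact Circle.norm_coe _
  -- The geometric sum is bounded independently of `N`, so dividing by `N` sends it to `0`.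
  have hsum (N : ℕ) : ‖∑ n ∈ Finset.Icc 1 N, z ^ n‖ ≤ 2 / ‖z - 1‖ := by
    have h1 : ∑ n ∈ Finset.Icc 1 N, z ^ n = z * ((z ^ N - 1) / (z - 1)) := by
      rw [← geom_sum_eq hz1, Finset.mul_sum, ← Finset.Ico_add_one_right_eq_Icc, Finset.sum_Ico_eq_sum_range]
      refine Finset.sum_congr rfl fun i _ => ?_
      ring
    rw [h1, norm_mul, hznorm, one_mul, norm_div]
    gcongr
    calc ‖z ^ N - 1‖ ≤ ‖z ^ N‖ + ‖(1 : ℂ)‖ := norm_sub_le _ _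
      _ = 2 := by rw [norm_pow, hznorm]; norm_num
  simp only [hpow]
  refine squeeze_zero_norm (a := fun N : ℕ => (2 / ‖z - 1‖) / N) (fun N => ?_)
    (tendsto_const_div_atTop_nhds_zero_nat _)
  rw [norm_mul, norm_inv, Complex.norm_natCast, mul_comm, ← div_eq_mul_inv]
  gcongr
  exact hsum N

/-- Weyl's equidistribution theorem for continuous functions on the circle. -/
theorem tendsto_average_continuous {x : ℝ} (hx : Irrational x) (f : C(AddCircle (1 : ℝ), ℂ)) :
    Tendsto (fun N : ℕ => (N : ℂ)⁻¹ * ∑ n ∈ Finset.Icc 1 N,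
        f (((n * x : ℝ)) : AddCircle (1 : ℝ)))
      atTop (𝓝 (∫ t : AddCircle (1 : ℝ), f t)) := by
  have hintg (h : C(AddCircle (1 : ℝ), ℂ)) : Integrable h (volume : Measure (AddCircle (1 : ℝ))) :=
    h.continuous.integrable_of_hasCompactSupport (HasCompactSupport.of_compactSpace h)
  -- Both sides are linear in the function, so the limit passes to trigonometric polynomials, which
  -- are uniformly dense.
  have hspan : ∀ p ∈ Submodule.span ℂ (range (@fourier 1)),
      Tendsto (fun N : ℕ => (N : ℂ)⁻¹ * ∑ n ∈ Finset.Icc 1 N,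
        p (((n * x : ℝ)) : AddCircle (1 : ℝ)))
      atTop (𝓝 (∫ t : AddCircle (1 : ℝ), p t)) := by
    intro p hp
    induction hp using Submodule.span_induction with
    | mem p hp =>
      obtain ⟨k, rfl⟩ := hp
      exact tendsto_average_fourier hx k
    | zero => simp
    | add p r _ _ hp hr =>
      simp only [ContinuousMap.add_apply, Finset.sum_add_distrib, mul_add]
      rw [integral_add (hintg p) (hintg r)]
      exact hp.add hr
    | smul a p _ hp =>
      simp only [ContinuousMap.smul_apply, smul_eq_mul, ← Finset.mul_sum]
      rw [integral_const_mul]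
      refine (hp.const_mul a).congr fun N => ?_
      ring
  have hf : f ∈ closure (Submodule.span ℂ (range (@fourier 1)) : Set C(AddCircle (1 : ℝ), ℂ)) := by
    rw [← Submodule.topologicalClosure_coe, span_fourier_closure_eq_top]
    trivial
  rw [Metric.tendsto_atTop]
  intro ε hε
  obtain ⟨p, hp, hfp⟩ := Metric.mem_closure_iff.1 hf (ε / 3) (by positivity)
  have hpt (t : AddCircle (1 : ℝ)) : ‖f t - p t‖ ≤ ε / 3 := by
    rw [← dist_eq_norm]
    exact (ContinuousMap.dist_apply_le_dist t).trans hfp.le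
  obtain ⟨N₀, hN₀⟩ := Metric.tendsto_atTop.1 (hspan p hp) (ε / 3) (by positivity)
  refine ⟨N₀, fun N hN => ?_⟩
  have h1 := hN₀ N hN
  have h2 : dist ((N : ℂ)⁻¹ * ∑ n ∈ Finset.Icc 1 N, f (((n * x : ℝ)) : AddCircle (1 : ℝ)))
      ((N : ℂ)⁻¹ * ∑ n ∈ Finset.Icc 1 N, p (((n * x : ℝ)) : AddCircle (1 : ℝ))) ≤ ε / 3 := by
    rw [dist_eq_norm, ← mul_sub, ← Finset.sum_sub_distrib, norm_mul, norm_inv, Complex.norm_natCast]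
    have h3 := norm_sum_le_of_le (Finset.Icc 1 N)
      (fun n _ => hpt (((n * x : ℝ)) : AddCircle (1 : ℝ)))
    rw [Finset.sum_const, Nat.card_Icc, add_tsub_cancel_right, nsmul_eq_mul] at h3
    rcases Nat.eq_zero_or_pos N with h0 | h0
    · simp [h0]; positivity
    · have : (0 : ℝ) < N := by exact_mod_cast h0
      rw [inv_mul_le_iff₀ this]
      exact h3
  have h3 : dist (∫ t : AddCircle (1 : ℝ), p t) (∫ t : AddCircle (1 : ℝ), f t) ≤ ε / 3 := by
    rw [dist_comm, dist_eq_norm, ← integral_sub (hintg f) (hintg p)]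
    have := norm_integral_le_of_norm_le_const (μ := (volume : Measure (AddCircle (1 : ℝ))))
      (Eventually.of_forall hpt)
    simpa [measureReal_def, AddCircle.measure_univ] using this
  have h4 := dist_triangle4 ((N : ℂ)⁻¹ * ∑ n ∈ Finset.Icc 1 N, f (((n * x : ℝ)) : AddCircle (1 : ℝ)))
    ((N : ℂ)⁻¹ * ∑ n ∈ Finset.Icc 1 N, p (((n * x : ℝ)) : AddCircle (1 : ℝ)))
    (∫ t : AddCircle (1 : ℝ), p t) (∫ t : AddCircle (1 : ℝ), f t)
  linarith

theorem tendsto_average_continuous_real {x : ℝ} (hx : Irrational x) (f : C(AddCircle (1 : ℝ), ℝ)) :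
    Tendsto (fun N : ℕ => (N : ℝ)⁻¹ * ∑ n ∈ Finset.Icc 1 N,
        f (((n * x : ℝ)) : AddCircle (1 : ℝ)))
      atTop (𝓝 (∫ t : AddCircle (1 : ℝ), f t)) := by
  have h := tendsto_average_continuous hx ⟨fun t => (f t : ℂ), by fun_prop⟩
  simp only [ContinuousMap.coe_mk, integral_complex_ofReal] at h
  refine ((Complex.continuous_re.tendsto _).comp h).congr fun N => ?_
  simp only [Function.comp_apply]
  rw [← Complex.ofReal_natCast, ← Complex.ofReal_inv, ← Complex.ofReal_sum, ← Complex.ofReal_mul,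
    Complex.ofReal_re]

/-- The multiples of an irrational number visit every open set of fractional parts with asymptotic
frequency at least its measure. -/
theorem eventually_lt_proportion_fract {x : ℝ} (hx : Irrational x) {U : Set ℝ} (hU : IsOpen U)
    (hU1 : U ⊆ Ioo 0 1) {c : ℝ} (hc : c < volume.real U) :
    ∀ᶠ N in atTop, c < proportion {n : ℕ | Int.fract (n * x) ∈ U} N := by
  rcases lt_or_ge c 0 with hc0 | hc0
  · exact Eventually.of_forall fun N => hc0.trans_le (proportion_nonneg _ _)
  have hUfin : volume U ≠ ⊤ :=
    measure_ne_top_of_subset (hU1.trans Ioo_subset_Icc_self) (by simp)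
  set V : Set (AddCircle (1 : ℝ)) := (fun t : ℝ => (t : AddCircle (1 : ℝ))) '' U with hV
  have hVo : IsOpen V := QuotientAddGroup.isOpenMap_coe U hU
  have hUV : ENNReal.ofReal c < volume V := by
    rw [AddCircle.add_projection_respects_measure 1 0 hVo.measurableSet]
    refine lt_of_lt_of_le ?_ (measure_mono (μ := volume) (s := U) fun t ht => ⟨⟨t, ht, rfl⟩, ?_⟩)
    · rwa [ENNReal.ofReal_lt_iff_lt_toReal hc0 hUfin]
    · have := hU1 ht
      exact ⟨this.1, by linarith [this.2]⟩
  -- Inner regularity and Urysohn: `f` lies between the indicators of `K` and `V`, so its averages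
  -- bound the frequency of visits from below while its integral still exceeds `c`.
  obtain ⟨K, hKV, hK, hcK⟩ := hVo.exists_lt_isCompact hUV
  obtain ⟨f, hf1, hf0, -, hf01⟩ := exists_continuous_one_zero_of_isCompact hK hVo.isClosed_compl
    (disjoint_compl_right_iff_subset.2 hKV)
  have hint : c < ∫ t, f t := by
    have h1 : volume.real K ≤ ∫ t, f t := by
      rw [← integral_indicator_one hK.measurableSet]
      refine integral_mono ?_ ?_ fun t => ?_
      · exact (integrable_const (1 : ℝ)).indicator hK.measurableSet
      · exact f.continuous.integrable_of_hasCompactSupport (HasCompactSupport.of_compactSpace f)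
      · by_cases ht : t ∈ K
        · simp [ht, hf1 ht]
        · simp [ht, (hf01 t).1]
    refine lt_of_lt_of_le ?_ h1
    rwa [ENNReal.ofReal_lt_iff_lt_toReal hc0 (measure_ne_top _ _)] at hcK
  filter_upwards [(tendsto_average_continuous_real hx f).eventually_const_lt hint,
    eventually_gt_atTop 0] with N hN hN0
  refine hN.trans_le ?_
  unfold proportion
  rw [div_eq_inv_mul]
  gcongr
  classical
  have hset : ({n : ℕ | Int.fract (n * x) ∈ U} ∩ Icc 1 N).ncard =
      ((Finset.Icc 1 N).filter fun n : ℕ => Int.fract (n * x) ∈ U).card := by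
    rw [← ncard_coe_finset]
    congr 1
    ext n
    simp [and_comm]
  rw [hset, Finset.card_filter]
  push_cast
  refine Finset.sum_le_sum fun n _ => ?_
  split_ifs with h
  · exact_mod_cast (hf01 _).2
  · have : ((n * x : ℝ) : AddCircle (1 : ℝ)) ∈ Vᶜ := by
      rintro ⟨u, hu, hun⟩
      apply h
      have h1 : Int.fract u = Int.fract (n * x) := by
        have h2 : ((u - n * x : ℝ) : AddCircle (1 : ℝ)) = 0 := by
          rw [AddCircle.coe_sub, sub_eq_zero]
          exact hun
        obtain ⟨z, hz⟩ := AddCircle.coe_eq_zero_iff (1 : ℝ) |>.1 h2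
        exact Int.fract_eq_fract.2 ⟨z, by rw [← hz]; simp⟩
      rw [← h1, Int.fract_eq_self.2 ⟨(hU1 hu).1.le, (hU1 hu).2⟩]
      exact hu
    exact_mod_cast (hf0 this).le

/-! ### The operator at the jump as a quotient of Hurwitz partial sums. -/

/-- Partial sums of the Hurwitz zeta series. -/
noncomputable def hurwitzPartial (s a : ℝ) (N : ℕ) : ℝ :=
  ∑ j ∈ Finset.range N, 1 / ((j : ℝ) + a) ^ s

theorem hurwitzPartial_nonneg (s : ℝ) {a : ℝ} (ha : 0 ≤ a) (N : ℕ) : 0 ≤ hurwitzPartial s a N :=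
  Finset.sum_nonneg fun j _ => by positivity

theorem one_div_rpow_le_hurwitzPartial (s : ℝ) {a : ℝ} (ha : 0 ≤ a) {N : ℕ} (hN : 0 < N) :
    1 / a ^ s ≤ hurwitzPartial s a N := by
  have := Finset.single_le_sum (f := fun j : ℕ => 1 / ((j : ℝ) + a) ^ s)
    (fun j _ => by positivity) (Finset.mem_range.2 hN)
  simpa [hurwitzPartial] using this

theorem ne_node_of_fract_ne_zero {n : ℕ} (hn : n ≠ 0) {x : ℝ} (hf : Int.fract (n * x) ≠ 0) (k : ℕ) :
    x ≠ k / n := by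
  rintro rfl
  apply hf
  rw [mul_div_cancel₀ _ (Nat.cast_ne_zero.2 hn)]
  exact Int.fract_natCast k

theorem floor_lt_of_fract_ne_zero {n : ℕ} {x : ℝ} (hx : x ∈ Icc (0 : ℝ) 1)
    (hf : Int.fract (n * x) ≠ 0) : ⌊n * x⌋₊ < n := by
  have hnx : (0 : ℝ) ≤ n * x := mul_nonneg (Nat.cast_nonneg _) hx.1
  rw [Nat.floor_lt hnx]
  refine lt_of_le_of_ne (mul_le_of_le_one_right (Nat.cast_nonneg _) hx.2) fun h => hf ?_
  rw [h]
  exact Int.fract_natCast n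

/-- The weights of the Shepard operators sum up to partial sums of Hurwitz zeta series. -/
theorem sum_weights_eq {n : ℕ} (hn : n ≠ 0) (s : ℝ) {x : ℝ} (hx : 0 ≤ x) :
    ∑ k ∈ Finset.range (⌊n * x⌋₊ + 1), |x - k / n| ^ (-s) =
        (n : ℝ) ^ s * hurwitzPartial s (Int.fract (n * x)) (⌊n * x⌋₊ + 1) ∧
      ∑ j ∈ Finset.range (n - ⌊n * x⌋₊), |x - (⌊n * x⌋₊ + 1 + j : ℕ) / n| ^ (-s) =
        (n : ℝ) ^ s * hurwitzPartial s (1 - Int.fract (n * x)) (n - ⌊n * x⌋₊) := by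
  have hn0 : (0 : ℝ) < n := by exact_mod_cast Nat.pos_of_ne_zero hn
  have hfm : (n : ℝ) * x = ⌊n * x⌋₊ + Int.fract (n * x) := by
    rw [natCast_floor_eq_intCast_floor (mul_nonneg hn0.le hx)]
    exact (Int.floor_add_fract _).symm
  have hf0 : 0 ≤ Int.fract (n * x) := Int.fract_nonneg _
  have hf1 : Int.fract (n * x) < 1 := Int.fract_lt_one _
  set m := ⌊n * x⌋₊ with hm
  set f := Int.fract (n * x) with hfdef
  have hw (k : ℕ) : |x - k / n| ^ (-s) = (n : ℝ) ^ s * (1 / |n * x - k| ^ s) := by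
    have : |x - k / n| = |n * x - k| / n := by
      rw [← abs_of_pos hn0, ← abs_div, abs_of_pos hn0]
      congr 1
      field_simp
    rw [this, Real.rpow_neg (by positivity), Real.div_rpow (abs_nonneg _) hn0.le, inv_div, mul_one_div]
  simp only [hw]
  constructor
  -- Reflection counts the left nodes outwards from `x`: the node `m - j` is at distance `(j + f) /
  -- n`.
  · rw [hurwitzPartial, ← Finset.sum_range_reflect, Finset.mul_sum]
    refine Finset.sum_congr rfl fun k hk => ?_
    have hkm : k ≤ m := Nat.lt_succ_iff.1 (Finset.mem_range.1 hk)
    have hkm' : (k : ℝ) ≤ m := by exact_mod_cast hkm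
    rw [Nat.add_sub_cancel, Nat.cast_sub hkm, hfm, abs_of_nonneg (by linarith)]
    congr 4
    ring
  · rw [hurwitzPartial, Finset.mul_sum]
    refine Finset.sum_congr rfl fun j _ => ?_
    have hj : (0 : ℝ) ≤ j := Nat.cast_nonneg j
    rw [hfm, abs_of_neg (by push_cast; linarith)]
    congr 4
    push_cast
    ring

/-- At a point which is not a node, the Shepard operator of the step function is a quotient of
partial sums of Hurwitz zeta series. -/
theorem shepard_step_eq {n : ℕ} (hn : n ≠ 0) (s d : ℝ) {x : ℝ} (hx : x ∈ Icc (0 : ℝ) 1)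
    (hf : Int.fract (n * x) ≠ 0) :
    shepard n s (step x d) x = hurwitzPartial s (Int.fract (n * x)) (⌊n * x⌋₊ + 1) /
      (hurwitzPartial s (Int.fract (n * x)) (⌊n * x⌋₊ + 1) +
        hurwitzPartial s (1 - Int.fract (n * x)) (n - ⌊n * x⌋₊)) := by
  have hn0 : (0 : ℝ) < n := by exact_mod_cast Nat.pos_of_ne_zero hn
  have hmn := floor_lt_of_fract_ne_zero hx hf
  obtain ⟨hleft, hright⟩ := sum_weights_eq hn s hx.1
  have hns : (0 : ℝ) < (n : ℝ) ^ s := by positivity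
  have hstepl : ∀ k ∈ Finset.range (⌊n * x⌋₊ + 1), step x d (k / n) = 1 := fun k hk => by
    have hk' : (k : ℝ) ≤ ⌊n * x⌋₊ := by exact_mod_cast Nat.lt_succ_iff.1 (Finset.mem_range.1 hk)
    have hkx : (k : ℝ) / n ≤ x := by
      rw [div_le_iff₀ hn0, mul_comm]
      exact hk'.trans (Nat.floor_le (mul_nonneg hn0.le hx.1))
    rw [step, if_pos (lt_of_le_of_ne hkx (ne_node_of_fract_ne_zero hn hf k).symm)]
  have hstepr (j : ℕ) : step x d ((⌊n * x⌋₊ + 1 + j : ℕ) / n) = 0 := by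
    have : x < ((⌊n * x⌋₊ + 1 + j : ℕ) : ℝ) / n := by
      rw [lt_div_iff₀ hn0, mul_comm]
      have hj : (0 : ℝ) ≤ j := Nat.cast_nonneg j
      have := Nat.lt_floor_add_one ((n : ℝ) * x)
      push_cast
      linarith
    rw [step, if_neg this.not_gt, if_neg this.ne']
  rw [shepard, if_neg fun ⟨k, _, hk⟩ => ne_node_of_fract_ne_zero hn hf k hk,
    show n + 1 = (⌊n * x⌋₊ + 1) + (n - ⌊n * x⌋₊) by omega, Finset.sum_range_add _ (⌊n * x⌋₊ + 1),
    Finset.sum_range_add _ (⌊n * x⌋₊ + 1), hleft, hright]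
  simp only [hstepr, zero_mul, Finset.sum_const_zero, add_zero]
  rw [Finset.sum_congr rfl fun k hk => by rw [hstepl k hk, one_mul], hleft, ← mul_add,
    mul_div_mul_left _ _ hns.ne']

theorem shepard_eq_of_fract_eq_zero {n : ℕ} (hn : n ≠ 0) (s : ℝ) (f : ℝ → ℝ) {x : ℝ}
    (hx : x ∈ Icc (0 : ℝ) 1) (hf : Int.fract (n * x) = 0) : shepard n s f x = f x := by
  have hn0 : (0 : ℝ) < n := by exact_mod_cast Nat.pos_of_ne_zero hn
  have hfm : (n : ℝ) * x = ⌊n * x⌋₊ := by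
    rw [natCast_floor_eq_intCast_floor (mul_nonneg hn0.le hx.1), ← sub_eq_zero]
    exact hf
  have hmn : ⌊(n : ℝ) * x⌋₊ ≤ n := by
    rw [← Nat.cast_le (α := ℝ), ← hfm]
    exact mul_le_of_le_one_right hn0.le hx.2
  refine if_pos ⟨⌊n * x⌋₊, Finset.mem_range.2 (by omega), ?_⟩
  rw [← hfm, mul_div_cancel_left₀ _ hn0.ne']

/-! ### The Hurwitz zeta function and `g s` for `s > 1`. -/

theorem summable_hurwitz {s : ℝ} (hs : 1 < s) {a : ℝ} (ha : 0 < a) :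
    Summable fun n : ℕ => 1 / ((n : ℝ) + a) ^ s := by
  refine ((Real.summable_one_div_nat_add_rpow a s).2 hs).congr fun n => ?_
  rw [abs_of_pos (by positivity)]

theorem hurwitz_anti {s : ℝ} (hs : 1 < s) {a b : ℝ} (ha : 0 < a) (hab : a ≤ b) :
    hurwitz s b ≤ hurwitz s a := by
  refine (summable_hurwitz hs (ha.trans_le hab)).tsum_le_tsum (fun n => ?_) (summable_hurwitz hs ha)
  gcongr

theorem one_le_hurwitz {s : ℝ} (hs : 1 < s) {a : ℝ} (ha : 0 < a) (ha1 : a ≤ 1) :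
    1 ≤ hurwitz s a := by
  have h := (summable_hurwitz hs ha).le_tsum 0 fun j _ => by positivity
  refine le_trans ?_ h
  rw [Nat.cast_zero, zero_add]
  exact one_le_one_div (by positivity) (Real.rpow_le_one ha.le ha1 (by linarith))

/-- The zeroth terms alone differ by `y ^ (-s) * ((y / x) ^ s - 1) ≥ y / x - 1 ≥ y - x`, and all
other terms also decrease in `a`. -/
theorem sub_le_hurwitz_sub {s : ℝ} (hs : 1 < s) {x y : ℝ} (hx : 0 < x) (hxy : x ≤ y) (hy : y ≤ 1) :
    y - x ≤ hurwitz s x - hurwitz s y := by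
  have hy0 : 0 < y := hx.trans_le hxy
  have hpow : y - x ≤ 1 / x ^ s - 1 / y ^ s := by
    have h1 : y / x ≤ (y / x) ^ s := Real.self_le_rpow_of_one_le ((one_le_div hx).2 hxy) hs.le
    rw [Real.div_rpow hy0.le hx.le] at h1
    have h2 : 1 ≤ 1 / y ^ s := one_le_one_div (by positivity) (Real.rpow_le_one hy0.le hy (by linarith))
    have h3 : y - x ≤ y / x - 1 := by
      rw [div_sub_one hx.ne', le_div_iff₀ hx]
      nlinarith
    have h4 : 1 / x ^ s - 1 / y ^ s = 1 / y ^ s * (y ^ s / x ^ s - 1) := by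
      have : y ^ s ≠ 0 := by positivity
      field_simp
    rw [h4]
    have h5 : 0 ≤ y - x := sub_nonneg.2 hxy
    nlinarith
  unfold hurwitz
  rw [← (summable_hurwitz hs hx).tsum_sub (summable_hurwitz hs hy0)]
  refine hpow.trans ?_
  have h := ((summable_hurwitz hs hx).sub (summable_hurwitz hs hy0)).le_tsum 0 fun j _ => by
    rw [sub_nonneg]
    gcongr
  simpa using h

theorem hurwitzPartial_le_hurwitz {s : ℝ} (hs : 1 < s) {a : ℝ} (ha : 0 < a) (N : ℕ) :
    hurwitzPartial s a N ≤ hurwitz s a :=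
  (summable_hurwitz hs ha).sum_le_tsum _ fun j _ => by positivity

/-- The partial sums converge to the Hurwitz zeta function uniformly in `a`. -/
theorem eventually_hurwitz_sub_le {s : ℝ} (hs : 1 < s) {ε : ℝ} (hε : 0 < ε) :
    ∀ᶠ N in atTop, ∀ a > 0, hurwitz s a - hurwitzPartial s a N ≤ ε := by
  have hsum := Real.summable_one_div_nat_rpow.2 hs
  filter_upwards [(tendsto_sum_nat_add fun n : ℕ => 1 / (n : ℝ) ^ s).eventually_le_const hε,
    eventually_gt_atTop 0] with N hN hN0 a ha
  refine le_trans ?_ hN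
  rw [hurwitz, hurwitzPartial, ← (summable_hurwitz hs ha).sum_add_tsum_nat_add N, add_sub_cancel_left]
  refine ((summable_nat_add_iff N).2 (summable_hurwitz hs ha)).tsum_le_tsum (fun n => ?_)
    ((summable_nat_add_iff N).2 hsum)
  have : (0 : ℝ) < (n + N : ℕ) := by exact_mod_cast (by omega)
  gcongr
  linarith

theorem g_of_mem_Ioo (s : ℝ) {t : ℝ} (ht : t ∈ Ioo (0 : ℝ) 1) :
    g s t = hurwitz s t / (hurwitz s t + hurwitz s (1 - t)) := by
  rw [g, if_neg ht.1.ne', if_neg ht.2.ne]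

/-- The series converges uniformly only away from `0`, so the M-test is applied on `(a / 2, ∞)`,
with the terms at `a / 2` as majorants. -/
theorem continuousOn_hurwitz {s : ℝ} (hs : 1 < s) : ContinuousOn (hurwitz s) (Ioi 0) := by
  intro a (ha : 0 < a)
  have hc : ContinuousOn (hurwitz s) (Ioi (a / 2)) := by
    refine continuousOn_tsum (fun n => ?_) (summable_hurwitz hs (half_pos ha)) fun n t ht => ?_
    · refine ContinuousOn.div continuousOn_const ?_ fun t (ht : a / 2 < t) => ?_
      · exact (continuousOn_const.add continuousOn_id).rpow_const fun t _ => Or.inr (by linarith)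
      · have : 0 < t := by linarith
        positivity
    · have ht' : a / 2 < t := ht
      have : 0 < t := by linarith
      rw [Real.norm_eq_abs, abs_of_nonneg (by positivity)]
      gcongr
  exact (hc.continuousAt (Ioi_mem_nhds (by linarith))).continuousWithinAt

theorem continuousOn_g {s : ℝ} (hs : 1 < s) : ContinuousOn (g s) (Ioo 0 1) := by
  have h1 : ContinuousOn (hurwitz s) (Ioo 0 1) := (continuousOn_hurwitz hs).mono fun t ht => ht.1
  have h2 : ContinuousOn (fun t => hurwitz s (1 - t)) (Ioo 0 1) :=
    (continuousOn_hurwitz hs).comp (continuousOn_const.sub continuousOn_id) fun t ht => by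
      simpa using ht.2
  refine (h1.div (h1.add h2) fun t ht => ?_).congr fun t ht => g_of_mem_Ioo s ht
  have := one_le_hurwitz hs ht.1 ht.2.le
  have := one_le_hurwitz hs (sub_pos.2 ht.2) (by linarith [ht.1])
  simp only [Pi.add_apply]
  positivity

/-- A quantitative form of the strict monotonicity of `g s`. -/
theorem sub_le_mul_g_sub {s : ℝ} (hs : 1 < s) {δ x y : ℝ} (hδ : 0 < δ) (hx : δ ≤ x) (hxy : x ≤ y)
    (hy : y ≤ 1 - δ) : y - x ≤ (2 * hurwitz s δ) ^ 2 * (g s x - g s y) := by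
  have hx0 : 0 < x := by linarith
  have hy0 : 0 < y := by linarith
  rw [g_of_mem_Ioo s ⟨hx0, by linarith⟩, g_of_mem_Ioo s ⟨hy0, by linarith⟩]
  have a1 := one_le_hurwitz hs hx0 (by linarith)
  have a2 := one_le_hurwitz hs hy0 (by linarith)
  have a3 := one_le_hurwitz hs (show 0 < 1 - x by linarith) (by linarith)
  have a4 := one_le_hurwitz hs (show 0 < 1 - y by linarith) (by linarith)
  have b1 := hurwitz_anti hs hδ hx
  have b2 := hurwitz_anti hs hδ (hx.trans hxy)
  have b3 := hurwitz_anti hs hδ (show δ ≤ 1 - x by linarith)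
  have b4 := hurwitz_anti hs hδ (show δ ≤ 1 - y by linarith)
  have c1 := sub_le_hurwitz_sub hs hx0 hxy (by linarith)
  have c2 := sub_le_hurwitz_sub hs (show 0 < 1 - y by linarith) (show 1 - y ≤ 1 - x by linarith)
    (by linarith)
  set X := hurwitz s x
  set Y := hurwitz s y
  set X' := hurwitz s (1 - x)
  set Y' := hurwitz s (1 - y)
  set D := hurwitz s δ
  have e : X / (X + X') - Y / (Y + Y') = (X * Y' - Y * X') / ((X + X') * (Y + Y')) := by
    have : X + X' ≠ 0 := by positivity
    have : Y + Y' ≠ 0 := by positivity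
    field_simp
    ring
  -- The right side is `X * (Y' - X') + X' * (X - Y)`, with `X, X' ≥ 1` and both differences at
  -- least `y - x`.
  have hnum : y - x ≤ X * Y' - Y * X' := by nlinarith
  have hden : (X + X') * (Y + Y') ≤ (2 * D) ^ 2 := by
    rw [sq]
    gcongr <;> linarith
  have hden0 : 0 < (X + X') * (Y + Y') := by positivity
  rw [e, ← mul_div_assoc, le_div_iff₀ hden0]
  have hnum0 : 0 ≤ X * Y' - Y * X' := (sub_nonneg.2 hxy).trans hnum
  calc (y - x) * ((X + X') * (Y + Y')) ≤ (X * Y' - Y * X') * (2 * D) ^ 2 := by gcongr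
    _ = _ := mul_comm _ _

theorem strictAntiOn_g {s : ℝ} (hs : 1 < s) : StrictAntiOn (g s) (Ioo 0 1) := by
  intro x hx y hy hxy
  have h := sub_le_mul_g_sub hs (δ := min x (1 - y)) (lt_min hx.1 (sub_pos.2 hy.2)) (min_le_left _ _)
    hxy.le (by linarith [min_le_right x (1 - y)])
  by_contra! hle
  have : (2 * hurwitz s (min x (1 - y))) ^ 2 * (g s x - g s y) ≤ 0 :=
    mul_nonpos_of_nonneg_of_nonpos (sq_nonneg _) (sub_nonpos.2 hle)
  linarith

/-- Over a common denominator the numerator is at most `ε * (A + B)` in absolute value, and `A' + B'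
≥ 1`. -/
theorem abs_div_add_sub_div_add_le {A B A' B' ε : ℝ} (hA : 0 ≤ A) (hB : 0 ≤ B) (hAA : A ≤ A')
    (hBB : B ≤ B') (hA' : A' - A ≤ ε) (hB' : B' - B ≤ ε) (h1 : 1 ≤ A + B) :
    |A / (A + B) - A' / (A' + B')| ≤ ε := by
  have hS : 0 < A + B := by linarith
  have hS' : 1 ≤ A' + B' := by linarith
  have hS'0 : 0 < A' + B' := by linarith
  have e : A / (A + B) - A' / (A' + B') =
      (A * (B' - B) - B * (A' - A)) / ((A + B) * (A' + B')) := by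
    have : A + B ≠ 0 := hS.ne'
    have : A' + B' ≠ 0 := hS'0.ne'
    field_simp
    ring
  rw [e, abs_div, abs_of_pos (mul_pos hS hS'0), div_le_iff₀ (mul_pos hS hS'0)]
  have hε : 0 ≤ ε := (sub_nonneg.2 hAA).trans hA'
  have h2 : |A * (B' - B) - B * (A' - A)| ≤ ε * (A + B) := by
    rw [abs_le]
    constructor <;> nlinarith [sub_nonneg.2 hAA, sub_nonneg.2 hBB]
  have h3 : 0 ≤ ε * (A + B) := mul_nonneg hε hS.le
  nlinarith

/-! ### Asymptotics at the jump. -/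

theorem tendsto_floor_mul_atTop {x : ℝ} (hx : 0 < x) :
    Tendsto (fun n : ℕ => ⌊n * x⌋₊) atTop atTop :=
  tendsto_nat_floor_atTop.comp (tendsto_natCast_atTop_atTop.atTop_mul_const hx)

theorem tendsto_sub_floor_mul_atTop {x : ℝ} (hx0 : 0 < x) (hx : x < 1) :
    Tendsto (fun n : ℕ => n - ⌊n * x⌋₊) atTop atTop := by
  refine tendsto_atTop_mono (fun n => ?_) (tendsto_floor_mul_atTop (sub_pos.2 hx))
  have h1 := Nat.floor_le (mul_nonneg (Nat.cast_nonneg n) hx0.le)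
  have h2 := Nat.floor_le (mul_nonneg (Nat.cast_nonneg n) (sub_pos.2 hx).le)
  have : ⌊(n : ℝ) * (1 - x)⌋₊ + ⌊(n : ℝ) * x⌋₊ ≤ n := by
    have : ((⌊(n : ℝ) * (1 - x)⌋₊ + ⌊(n : ℝ) * x⌋₊ : ℕ) : ℝ) ≤ n := by
      push_cast
      linarith
    exact_mod_cast this
  omega

/-- For `s > 1`, the values of the Shepard operators at the jump are asymptotic to the values of
`g s` at the fractional parts of `n * x`. -/
theorem eventually_abs_shepard_sub_g_le {s : ℝ} (hs : 1 < s) (d : ℝ) {x : ℝ}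
    (hx : x ∈ Ioo (0 : ℝ) 1) {ε : ℝ} (hε : 0 < ε) :
    ∀ᶠ n : ℕ in atTop, Int.fract (n * x) ≠ 0 →
      |shepard n s (step x d) x - g s (Int.fract (n * x))| ≤ ε := by
  have hN1 := (tendsto_add_atTop_nat 1).comp (tendsto_floor_mul_atTop hx.1)
  filter_upwards [hN1.eventually (eventually_hurwitz_sub_le hs hε),
    (tendsto_sub_floor_mul_atTop hx.1 hx.2).eventually (eventually_hurwitz_sub_le hs hε),
    eventually_ne_atTop 0] with n h1 h2 hn hf
  have hf0 : 0 < Int.fract (n * x) := lt_of_le_of_ne (Int.fract_nonneg _) (Ne.symm hf)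
  have hf1 : Int.fract (n * x) < 1 := Int.fract_lt_one _
  rw [shepard_step_eq hn s d ⟨hx.1.le, hx.2.le⟩ hf, g_of_mem_Ioo s ⟨hf0, hf1⟩]
  refine abs_div_add_sub_div_add_le (hurwitzPartial_nonneg s hf0.le _)
    (hurwitzPartial_nonneg s (sub_pos.2 hf1).le _) (hurwitzPartial_le_hurwitz hs hf0 _)
    (hurwitzPartial_le_hurwitz hs (sub_pos.2 hf1) _) (h1 _ hf0) (h2 _ (sub_pos.2 hf1)) ?_
  have h3 := one_div_rpow_le_hurwitzPartial s hf0.le (Nat.succ_pos ⌊n * x⌋₊)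
  have h4 : 1 ≤ 1 / Int.fract (n * x) ^ s :=
    one_le_one_div (by positivity) (Real.rpow_le_one hf0.le hf1.le (by linarith))
  linarith [hurwitzPartial_nonneg s (sub_pos.2 hf1).le (n - ⌊n * x⌋₊)]

theorem log_le_hurwitzPartial_one {a : ℝ} (ha0 : 0 < a) (ha : a ≤ 1) (N : ℕ) :
    Real.log (N + 1) ≤ hurwitzPartial 1 a N := by
  refine (by exact_mod_cast log_add_one_le_harmonic N : Real.log (N + 1) ≤ (harmonic N : ℝ)).trans ?_
  rw [harmonic, hurwitzPartial]
  push_cast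
  refine Finset.sum_le_sum fun j _ => ?_
  rw [Real.rpow_one, ← one_div]
  gcongr

/-- The zeroth term `1 / a` is split off and the others are at most `1 / j`. The separate `M` lets
the left and right sums be compared with the same `log n`. -/
theorem hurwitzPartial_one_le {a : ℝ} (ha : 0 < a) {N M : ℕ} (hNM : N ≤ M + 1) :
    hurwitzPartial 1 a N ≤ 1 / a + 1 + Real.log M := by
  have h1 : hurwitzPartial 1 a N ≤ hurwitzPartial 1 a (M + 1) :=
    Finset.sum_le_sum_of_subset_of_nonneg (Finset.range_mono hNM) fun j _ _ => by positivity
  have h2 : hurwitzPartial 1 a (M + 1) ≤ 1 / a + harmonic M := by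
    rw [hurwitzPartial, Finset.sum_range_succ', harmonic, add_comm]
    push_cast
    simp only [Real.rpow_one, zero_add]
    gcongr with j _
    rw [← one_div]
    exact one_div_le_one_div_of_le (by positivity) (by linarith)
  linarith [harmonic_le_one_add_log M]

/-- For `s = 1`, the values of the Shepard operators at the jump tend to `1 / 2` as long as the
fractional part of `n * x` stays away from the integers. -/
theorem eventually_abs_shepard_sub_half_lt (d : ℝ) {x : ℝ} (hx : x ∈ Ioo (0 : ℝ) 1) {δ ε : ℝ}
    (hδ : 0 < δ) (hε : 0 < ε) :
    ∀ᶠ n : ℕ in atTop, Int.fract (n * x) ∈ Icc δ (1 - δ) →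
      |shepard n 1 (step x d) x - 1 / 2| < ε := by
  -- Both sums lie between `log n + c` and `1 / δ + 1 + log n`, so they differ by at most `C` while
  -- their sum tends to infinity.
  set c := min (Real.log x) (Real.log (1 - x)) with hc
  set C := 1 / δ + 1 - c with hC
  have hlog : Tendsto (fun n : ℕ => Real.log n) atTop atTop :=
    Real.tendsto_log_atTop.comp tendsto_natCast_atTop_atTop
  filter_upwards [hlog.eventually_gt_atTop (-c), hlog.eventually_gt_atTop (C / ε - c),
    eventually_ne_atTop 0] with n h1 h2 hn hf
  have hn0 : (0 : ℝ) < n := by exact_mod_cast Nat.pos_of_ne_zero hn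
  have hf0 : 0 < Int.fract (n * x) := hδ.trans_le hf.1
  have hf1 : 0 < 1 - Int.fract (n * x) := by linarith [hf.2]
  have hnx : 0 ≤ (n : ℝ) * x := mul_nonneg hn0.le hx.1.le
  rw [shepard_step_eq hn 1 d ⟨hx.1.le, hx.2.le⟩ hf0.ne']
  have hm := floor_lt_of_fract_ne_zero ⟨hx.1.le, hx.2.le⟩ hf0.ne'
  have hAu := hurwitzPartial_one_le hf0 (show ⌊n * x⌋₊ + 1 ≤ n + 1 by omega)
  have hBu := hurwitzPartial_one_le hf1 (show n - ⌊n * x⌋₊ ≤ n + 1 by omega)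
  have hAl := log_le_hurwitzPartial_one hf0 (by linarith) (⌊n * x⌋₊ + 1)
  have hBl := log_le_hurwitzPartial_one hf1 (by linarith) (n - ⌊n * x⌋₊)
  have hA0 : Real.log n + c ≤ Real.log ((⌊n * x⌋₊ + 1 : ℕ) + 1) := by
    calc Real.log n + c ≤ Real.log n + Real.log x := by gcongr; exact min_le_left _ _
      _ = Real.log (n * x) := (Real.log_mul hn0.ne' hx.1.ne').symm
      _ ≤ _ := by
        refine Real.log_le_log (mul_pos hn0 hx.1) ?_
        have := Nat.lt_floor_add_one ((n : ℝ) * x)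
        push_cast
        linarith
  have hB0 : Real.log n + c ≤ Real.log ((n - ⌊n * x⌋₊ : ℕ) + 1) := by
    calc Real.log n + c ≤ Real.log n + Real.log (1 - x) := by gcongr; exact min_le_right _ _
      _ = Real.log (n * (1 - x)) := (Real.log_mul hn0.ne' (sub_pos.2 hx.2).ne').symm
      _ ≤ _ := by
        refine Real.log_le_log (mul_pos hn0 (sub_pos.2 hx.2)) ?_
        have := Nat.floor_le hnx
        rw [Nat.cast_sub hm.le]
        linarith
  have hd1 : 1 / Int.fract (n * x) ≤ 1 / δ := one_div_le_one_div_of_le hδ hf.1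
  have hd2 : 1 / (1 - Int.fract (n * x)) ≤ 1 / δ := one_div_le_one_div_of_le hδ (by linarith [hf.2])
  set A := hurwitzPartial 1 (Int.fract (n * x)) (⌊n * x⌋₊ + 1)
  set B := hurwitzPartial 1 (1 - Int.fract (n * x)) (n - ⌊n * x⌋₊)
  have hAB : 0 < A + B := by linarith
  have hd : |A - B| ≤ C := by
    rw [abs_le]
    constructor <;> linarith
  have e : A / (A + B) - 1 / 2 = (A - B) / (2 * (A + B)) := by
    field_simp
    ring
  rw [e, abs_div, abs_of_pos (mul_pos two_pos hAB), div_lt_iff₀ (by positivity)]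
  have h3 : C < (Real.log n + c) * ε := by
    rw [← div_lt_iff₀ hε]
    linarith
  nlinarith

/-! ### Uniform convergence away from the jump. -/

/-- All distances are at most `1`, so `s = 1` is the worst case. There the two logarithmic lower
bounds combine through `(m + 2) * (n - m + 1) ≥ n + 1`, where `m` is the integer part of `n * x`. -/
theorem mul_log_le_sum_weights {n : ℕ} (hn : n ≠ 0) {s : ℝ} (hs : 1 ≤ s) {x : ℝ}
    (hx : x ∈ Icc (0 : ℝ) 1) (hf : Int.fract (n * x) ≠ 0) :
    n * Real.log (n + 1) ≤ ∑ k ∈ Finset.range (n + 1), |x - k / n| ^ (-s) := by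
  have hn0 : (0 : ℝ) < n := by exact_mod_cast Nat.pos_of_ne_zero hn
  have hf0 : 0 < Int.fract (n * x) := lt_of_le_of_ne (Int.fract_nonneg _) (Ne.symm hf)
  have hf1 : 0 < 1 - Int.fract (n * x) := sub_pos.2 (Int.fract_lt_one _)
  have hm := floor_lt_of_fract_ne_zero hx hf
  have h1 : ∑ k ∈ Finset.range (n + 1), |x - k / n| ^ (-(1 : ℝ)) ≤
      ∑ k ∈ Finset.range (n + 1), |x - k / n| ^ (-s) := by
    refine Finset.sum_le_sum fun k hk => ?_
    refine Real.rpow_le_rpow_of_exponent_ge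
      (abs_pos.2 (sub_ne_zero.2 (ne_node_of_fract_ne_zero hn hf k))) ?_ (by linarith)
    have hk' : (k : ℝ) ≤ n := by exact_mod_cast Nat.lt_succ_iff.1 (Finset.mem_range.1 hk)
    have hk1 : (k : ℝ) / n ≤ 1 := div_le_one_of_le₀ hk' hn0.le
    have hk0 : 0 ≤ (k : ℝ) / n := by positivity
    rw [abs_le]
    constructor <;> linarith [hx.1, hx.2]
  refine le_trans ?_ h1
  obtain ⟨hleft, hright⟩ := sum_weights_eq hn 1 hx.1
  rw [show n + 1 = (⌊n * x⌋₊ + 1) + (n - ⌊n * x⌋₊) by omega, Finset.sum_range_add _ (⌊n * x⌋₊ + 1),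
    hleft, hright, Real.rpow_one, ← mul_add]
  gcongr
  have hAl := log_le_hurwitzPartial_one hf0 (by linarith) (⌊n * x⌋₊ + 1)
  have hBl := log_le_hurwitzPartial_one hf1 (by linarith) (n - ⌊n * x⌋₊)
  refine le_trans ?_ (add_le_add hAl hBl)
  rw [← Real.log_mul (by positivity) (by positivity)]
  refine Real.log_le_log (by positivity) ?_
  rw [Nat.cast_sub hm.le]
  have h3 : (⌊n * x⌋₊ : ℝ) ≤ n := by exact_mod_cast hm.le
  have h4 : (0 : ℝ) ≤ ⌊n * x⌋₊ := Nat.cast_nonneg _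
  push_cast
  nlinarith

/-- A point `t` closer than `δ` to `x` is on the same side of the jump and contributes nothing;
otherwise the weight is at most `δ ^ (-s)`. -/
theorem abs_step_sub_step_mul_rpow_le {x₀ d s x t δ : ℝ} (hs : 0 ≤ s) (hδ : 0 < δ)
    (hx : δ ≤ |x - x₀|) :
    |(step x₀ d t - step x₀ d x) * |x - t| ^ (-s)| ≤ (1 + |d|) * δ ^ (-s) := by
  have hd := abs_nonneg d
  have hle : |step x₀ d t - step x₀ d x| ≤ 1 + |d| := by
    have hne : x ≠ x₀ := by
      rintro rfl
      simp at hx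
      linarith
    have h1 : |d| ≤ 1 + |d| := by linarith
    have h2 : |d - 1| ≤ 1 + |d| := by
      have := abs_sub d 1
      simpa [add_comm] using this
    unfold step
    split_ifs <;> simp <;> linarith
  have hpos : 0 < δ ^ (-s) := by positivity
  by_cases hxt : δ ≤ |x - t|
  · rw [abs_mul, abs_of_nonneg (Real.rpow_nonneg (abs_nonneg (x - t)) _)]
    have := Real.rpow_le_rpow_of_nonpos hδ hxt (neg_nonpos.2 hs)
    gcongr
  · have : step x₀ d t = step x₀ d x := by
      rw [not_le, abs_lt] at hxt
      rcases le_abs.1 hx with h | h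
      · have h1 : x₀ < x := by linarith
        have h2 : x₀ < t := by linarith
        simp [step, h1.not_gt, h2.not_gt, h1.ne', h2.ne']
      · have h1 : x < x₀ := by linarith
        have h2 : t < x₀ := by linarith
        simp [step, h1, h2]
    rw [this, sub_self, zero_mul, abs_zero]
    positivity

theorem abs_shepard_step_sub_le {n : ℕ} (hn : n ≠ 0) {s x₀ x δ : ℝ} (d : ℝ) (hs : 1 ≤ s) (hδ : 0 < δ)
    (hx : x ∈ Icc (0 : ℝ) 1) (hxδ : δ ≤ |x - x₀|) :
    |shepard n s (step x₀ d) x - step x₀ d x| ≤ 2 * ((1 + |d|) * δ ^ (-s)) / Real.log (n + 1) := by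
  have hn0 : (0 : ℝ) < n := by exact_mod_cast Nat.pos_of_ne_zero hn
  have hn1 : (1 : ℝ) ≤ n := by exact_mod_cast Nat.one_le_iff_ne_zero.2 hn
  have hlog : 0 < Real.log (n + 1) := Real.log_pos (by linarith)
  have hd := abs_nonneg d
  by_cases hf : Int.fract (n * x) = 0
  · rw [shepard_eq_of_fract_eq_zero hn s _ hx hf, sub_self, abs_zero]
    positivity
  have hW := mul_log_le_sum_weights hn hs hx hf
  have hW0 := (mul_pos hn0 hlog).trans_le hW
  rw [shepard, if_neg fun ⟨k, _, hk⟩ => ne_node_of_fract_ne_zero hn hf k hk, div_sub' hW0.ne',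
    mul_comm _ (step x₀ d x), Finset.mul_sum, ← Finset.sum_sub_distrib, abs_div, abs_of_pos hW0]
  simp only [← sub_mul]
  have hnum : |∑ k ∈ Finset.range (n + 1), (step x₀ d (k / n) - step x₀ d x) * |x - k / n| ^ (-s)| ≤
      2 * n * ((1 + |d|) * δ ^ (-s)) := by
    refine (Finset.abs_sum_le_sum_abs _ _).trans ?_
    have hterm : ∀ k ∈ Finset.range (n + 1),
        |(step x₀ d (k / n) - step x₀ d x) * |x - k / n| ^ (-s)| ≤ (1 + |d|) * δ ^ (-s) :=
      fun k _ => abs_step_sub_step_mul_rpow_le (zero_le_one.trans hs) hδ hxδ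
    refine (Finset.sum_le_sum hterm).trans ?_
    rw [Finset.sum_const, Finset.card_range, nsmul_eq_mul]
    gcongr
    push_cast
    linarith
  calc _ ≤ 2 * n * ((1 + |d|) * δ ^ (-s)) / (n * Real.log (n + 1)) := by gcongr
    _ = _ := by field_simp

theorem tendstoUniformlyOn_shepard_step {s x₀ : ℝ} (d : ℝ) (hs : 1 ≤ s) {K : Set ℝ}
    (hK : IsCompact K) (hKx : K ⊆ Icc (0 : ℝ) 1 \ {x₀}) :
    TendstoUniformlyOn (fun n : ℕ => shepard n s (step x₀ d)) (step x₀ d) atTop K := by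
  obtain ⟨δ, hδ, hball⟩ := Metric.isOpen_iff.1 hK.isClosed.isOpen_compl x₀ fun h => (hKx h).2 rfl
  have hlim : Tendsto (fun n : ℕ => 2 * ((1 + |d|) * δ ^ (-s)) / Real.log (n + 1)) atTop (𝓝 0) := by
    refine tendsto_const_nhds.div_atTop (Real.tendsto_log_atTop.comp ?_)
    exact tendsto_atTop_add_const_right _ _ tendsto_natCast_atTop_atTop
  rw [Metric.tendstoUniformlyOn_iff]
  intro ε hε
  filter_upwards [hlim.eventually_lt_const hε, eventually_ne_atTop 0] with n hn hn0 x hx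
  rw [dist_comm, Real.dist_eq]
  refine (abs_shepard_step_sub_le hn0 d hs hδ (hKx hx).1 ?_).trans_lt hn
  by_contra! h
  exact hball (Metric.mem_ball.2 h) hx

/-! ### One-sided Diophantine approximation. -/

theorem fract_natCast_mul_pos {x : ℝ} (hx : Irrational x) {n : ℕ} (hn : n ≠ 0) :
    0 < Int.fract (n * x) := by
  refine lt_of_le_of_ne (Int.fract_nonneg _) fun h => ?_
  obtain ⟨z, hz⟩ := Int.fract_eq_zero_iff.1 h.symm
  exact (hx.natCast_mul hn).ne_int z hz.symm

/-- Serves to force large denominators: a multiple of `x` within `δ` of an integer must have index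
beyond `M`. -/
theorem exists_forall_lt_fract {x : ℝ} (hx : Irrational x) (M : ℕ) :
    ∃ δ > 0, ∀ j ∈ Icc 1 M, δ < Int.fract (j * x) ∧ Int.fract (j * x) < 1 - δ := by
  have hev : ∀ j ∈ Icc 1 M, ∀ᶠ δ in 𝓝[>] (0 : ℝ),
      δ < Int.fract (j * x) ∧ Int.fract (j * x) < 1 - δ := by
    intro j hj
    have h0 := fract_natCast_mul_pos hx (Nat.one_le_iff_ne_zero.1 hj.1)
    have h1 : 0 < 1 - Int.fract (j * x) := sub_pos.2 (Int.fract_lt_one _)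
    filter_upwards [Ioo_mem_nhdsGT h0, Ioo_mem_nhdsGT h1] with δ h2 h3
    exact ⟨h2.2, by linarith [h3.2]⟩
  obtain ⟨δ, h1, h2⟩ := ((((finite_Icc 1 M).eventually_all).2 hev).and self_mem_nhdsWithin).exists
  exact ⟨δ, h2, h1⟩

/-- Dirichlet approximation by reduced fractions with large denominators. -/
theorem exists_rat_den_gt {x : ℝ} (hx : Irrational x) (M : ℕ) :
    ∃ r : ℚ, M < r.den ∧ |r.den * x - r.num| < 1 / r.den := by
  obtain ⟨δ, hδ, hfr⟩ := exists_forall_lt_fract hx M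
  obtain ⟨N, hN⟩ := exists_nat_one_div_lt (lt_min hδ one_pos)
  obtain ⟨r, hr, hden⟩ := Real.exists_rat_abs_sub_le_and_den_le x (Nat.succ_pos N)
  have hd0 : (0 : ℝ) < r.den := by exact_mod_cast r.den_pos
  have hden' : (r.den : ℝ) ≤ N + 1 := by exact_mod_cast hden
  have habs : |r.den * x - r.num| ≤ 1 / (N + 2) := by
    have e : (r.den : ℝ) * x - r.num = r.den * (x - r) := by
      rw [mul_sub]
      congr 1
      exact_mod_cast (Rat.den_mul_eq_num r).symm
    rw [e, abs_mul, abs_of_pos hd0]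
    calc _ ≤ (r.den : ℝ) * (1 / ((((N + 1 : ℕ) : ℝ) + 1) * r.den)) := by gcongr
      _ = 1 / (N + 2) := by
        push_cast
        field_simp
        ring
  have hlt : (1 : ℝ) / (N + 2) < 1 / (N + 1) := by
    apply one_div_lt_one_div_of_lt <;> linarith [(Nat.cast_nonneg N : (0 : ℝ) ≤ N)]
  refine ⟨r, ?_, (habs.trans_lt hlt).trans_le (one_div_le_one_div_of_le hd0 hden')⟩
  by_contra! hM
  obtain ⟨h1, h2⟩ := hfr r.den ⟨r.den_pos, hM⟩
  have hb := (habs.trans_lt hlt).trans hN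
  rw [lt_min_iff, abs_lt, abs_lt] at hb
  have h3 := Int.floor_add_fract (r.den * x)
  have h4 : ⌊r.den * x⌋ = r.num ∨ ⌊r.den * x⌋ = r.num - 1 := by
    have a1 : (⌊r.den * x⌋ : ℝ) < r.num + 1 := by
      linarith [Int.floor_le (r.den * x), hb.2.2]
    have a2 : (r.num : ℝ) - 1 < ⌊r.den * x⌋ + 1 := by
      linarith [Int.lt_floor_add_one (r.den * x), hb.2.1]
    have a3 : ⌊r.den * x⌋ < r.num + 1 := by exact_mod_cast a1
    have a4 : r.num - 1 < ⌊r.den * x⌋ + 1 := by exact_mod_cast a2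
    omega
  rcases h4 with h4 | h4 <;> rw [h4] at h3 <;> push_cast at h3 <;> linarith [hb.1.1, hb.1.2]

/-- One-sided Dirichlet approximation. -/
theorem exists_gt_fract_lt {x : ℝ} (hx : Irrational x) (M : ℕ) :
    ∃ k : ℕ, M < k ∧ Int.fract (k * x) < 1 / k := by
  obtain ⟨δ, hδ, hfr⟩ := exists_forall_lt_fract hx M
  obtain ⟨N, hN⟩ := exists_nat_one_div_lt hδ
  obtain ⟨r, hden, hr⟩ := exists_rat_den_gt hx (max (M + 1) (N + 1))
  have hbM : M + 1 < r.den := (le_max_left _ _).trans_lt hden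
  have hbN : N + 1 < r.den := (le_max_right _ _).trans_lt hden
  have hd0 : (0 : ℝ) < r.den := by exact_mod_cast r.den_pos
  have hbδ : 1 / (r.den : ℝ) < δ := by
    refine lt_of_le_of_lt (one_div_le_one_div_of_le (by positivity) ?_) hN
    exact_mod_cast hbN.le
  have hb1 : 1 / (r.den : ℝ) ≤ 1 := by
    rw [div_le_one hd0]
    exact_mod_cast r.den_pos
  rw [abs_lt] at hr
  rcases le_or_gt (r.num : ℝ) (r.den * x) with hle | hlt
  · refine ⟨r.den, by omega, ?_⟩
    have : Int.fract (r.den * x) = r.den * x - r.num :=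
      Int.fract_eq_iff.2 ⟨by linarith, by linarith [hr.2], r.num, by ring⟩
    rw [this]
    exact hr.2
  -- Here `r = a / b` exceeds `x`. With `k` the inverse of `a` modulo `b`, `k * a = 1 + w * b`, so
  -- `k * x` exceeds `w` by `(1 - k * (a - b * x)) / b`, which is below `1 / b ≤ 1 / k`.
  · obtain ⟨u, v, huv⟩ : IsCoprime r.num r.den := by
      rw [Int.isCoprime_iff_gcd_eq_one, Int.gcd, Int.natAbs_natCast]
      exact r.reduced
    obtain ⟨k, hk⟩ := Int.eq_ofNat_of_zero_le
      (Int.emod_nonneg u (by exact_mod_cast r.den_ne_zero : (r.den : ℤ) ≠ 0))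
    have hkb : k < r.den := by
      have := Int.emod_lt_of_pos u (by exact_mod_cast r.den_pos : (0 : ℤ) < r.den)
      rw [hk] at this
      exact_mod_cast this
    obtain ⟨w, hw⟩ : ∃ w : ℤ, (k : ℤ) * r.num = 1 + w * r.den := by
      refine ⟨-v - (u / r.den) * r.num, ?_⟩
      have := Int.emod_add_mul_ediv u r.den
      rw [hk] at this
      linear_combination r.num * this + huv
    have hk0 : k ≠ 0 := by
      rintro rfl
      have h1 : (r.den : ℤ) ∣ 1 := ⟨-w, by push_cast at hw; linear_combination -hw⟩
      have h2 := Int.le_of_dvd one_pos h1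
      omega
    have hk0' : (0 : ℝ) < k := by exact_mod_cast Nat.pos_of_ne_zero hk0
    have hkb' : (k : ℝ) ≤ r.den := by exact_mod_cast hkb.le
    have hw' : (k : ℝ) * r.num = 1 + w * r.den := by exact_mod_cast hw
    have hη0 : 0 < r.num - r.den * x := by linarith
    have hη1 : k * (r.num - r.den * x) < 1 := by
      calc k * (r.num - r.den * x) ≤ r.den * (r.num - r.den * x) := by gcongr
        _ < r.den * (1 / r.den) := by
          gcongr
          linarith [hr.1]
        _ = 1 := by field_simp
    have hfk : Int.fract (k * x) = (1 - k * (r.num - r.den * x)) / r.den := by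
      refine Int.fract_eq_iff.2 ⟨div_nonneg (by linarith) hd0.le, ?_, w, ?_⟩
      · rw [div_lt_one hd0]
        have : (1 : ℝ) ≤ r.den := by exact_mod_cast r.den_pos
        linarith [mul_pos hk0' hη0]
      · field_simp
        linear_combination hw'
    have hlt' : Int.fract (k * x) < 1 / r.den := by
      rw [hfk]
      gcongr
      linarith [mul_pos hk0' hη0]
    refine ⟨k, ?_, hlt'.trans_le (one_div_le_one_div_of_le hk0' hkb')⟩
    by_contra! hkM
    linarith [(hfr k ⟨Nat.one_le_iff_ne_zero.2 hk0, hkM⟩).1]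

/-! ### Measure of preimages under `g s`. -/

/-- Preimages of null sets under `g s` are null. -/
theorem volume_preimage_g_eq_zero {s : ℝ} (hs : 1 < s) {B : Set ℝ} (hB : volume B = 0) :
    volume (Ioo 0 1 ∩ g s ⁻¹' B) = 0 := by
  set Z : ℕ → Set ℝ := fun k => Icc (1 / ((k : ℝ) + 1)) (1 - 1 / (k + 1)) ∩ g s ⁻¹' B with hZ
  have hsub : Ioo 0 1 ∩ g s ⁻¹' B ⊆ ⋃ k, Z k := by
    rintro t ⟨ht, htB⟩
    obtain ⟨k, hk⟩ := exists_nat_one_div_lt (lt_min ht.1 (sub_pos.2 ht.2))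
    rw [lt_min_iff] at hk
    exact mem_iUnion.2 ⟨k, ⟨hk.1.le, by linarith [hk.2]⟩, htB⟩
  refine measure_mono_null hsub (measure_iUnion_null fun k => ?_)
  have hk : (0 : ℝ) < 1 / ((k : ℝ) + 1) := by positivity
  have hanti : ∀ x ∈ Z k, ∀ y ∈ Z k,
      dist x y ≤ (2 * hurwitz s (1 / ((k : ℝ) + 1))) ^ 2 * dist (g s x) (g s y) := by
    intro x hx y hy
    wlog hxy : x ≤ y generalizing x y
    · rw [dist_comm x, dist_comm (g s x)]
      exact this y hy x hx (le_of_not_ge hxy)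
    rw [dist_comm, Real.dist_eq, Real.dist_eq, abs_of_nonneg (sub_nonneg.2 hxy)]
    refine (sub_le_mul_g_sub hs hk hx.1.1 hxy hy.1.2).trans ?_
    gcongr
    exact le_abs_self _
  have hinj : InjOn (g s) (Z k) := fun x hx y hy hxy => by
    have := hanti x hx y hy
    rw [hxy, dist_self, mul_zero] at this
    exact dist_le_zero.1 this
  -- The inverse of `g s` is Lipschitz on the image of `Z k`, so it preserves sets of
  -- one-dimensional Hausdorff measure zero; on the line this is Lebesgue measure.
  have hlip : LipschitzOnWith (((2 * hurwitz s (1 / ((k : ℝ) + 1))) ^ 2).toNNReal)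
      (Function.invFunOn (g s) (Z k)) (g s '' Z k) := by
    refine LipschitzOnWith.of_dist_le_mul ?_
    rintro _ ⟨x, hx, rfl⟩ _ ⟨y, hy, rfl⟩
    rw [hinj.leftInvOn_invFunOn hx, hinj.leftInvOn_invFunOn hy, Real.coe_toNNReal _ (sq_nonneg _)]
    exact hanti x hx y hy
  have h := hlip.hausdorffMeasure_image_le zero_le_one
  rw [hausdorffMeasure_real, hinj.leftInvOn_invFunOn.image_image] at h
  refine le_antisymm (h.trans ?_) bot_le
  rw [measure_mono_null (image_subset_iff.2 fun t ht => ht.2) hB, mul_zero]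

theorem gPreimage_subset (s : ℝ) (A : Set ℝ) :
    gPreimage s A ⊆ {0, 1} ∪ (Ioo 0 1 ∩ g s ⁻¹' A) := by
  rintro t ⟨⟨h0, h1⟩, hA⟩
  rcases h0.eq_or_lt with rfl | h0
  · simp
  rcases h1.eq_or_lt with rfl | h1
  · simp
  exact Or.inr ⟨⟨h0, h1⟩, hA⟩

theorem volume_pair_zero_one : volume ({0, 1} : Set ℝ) = 0 :=
  (Set.toFinite _).measure_zero _

theorem volume_preimage_frontier {s : ℝ} (hs : 1 < s) {A : Set ℝ} (hA : volume (frontier A) = 0) :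
    volume ({0, 1} ∪ (Ioo 0 1 ∩ g s ⁻¹' frontier A) : Set ℝ) = 0 :=
  measure_union_null volume_pair_zero_one (volume_preimage_g_eq_zero hs hA)

/-- By continuity of `g s` on `(0, 1)`, a boundary point of the preimage there is mapped into the
boundary of `A`. The end points form a null set. -/
theorem isJordanMeasurable_gPreimage {s : ℝ} (hs : 1 < s) {A : Set ℝ}
    (hA : volume (frontier A) = 0) : IsJordanMeasurable (gPreimage s A) := by
  refine ⟨(Metric.isBounded_Icc (0 : ℝ) 1).subset fun t ht => ht.1, ?_⟩
  refine measure_mono_null (fun t ht => ?_) (volume_preimage_frontier hs hA)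
  have ht01 : t ∈ Icc (0 : ℝ) 1 :=
    closure_minimal (fun t ht => ht.1) isClosed_Icc (frontier_subset_closure ht)
  rcases ht01.1.eq_or_lt with rfl | h0
  · simp
  rcases ht01.2.eq_or_lt with rfl | h1
  · simp
  refine Or.inr ⟨⟨h0, h1⟩, ?_⟩
  have hnhds : Ioo (0 : ℝ) 1 ∈ 𝓝 t := Ioo_mem_nhds h0 h1
  have hcont : ContinuousAt (g s) t := (continuousOn_g hs).continuousAt hnhds
  by_contra hfr
  have hfr' : t ∉ frontier (gPreimage s A) := by
    rw [mem_preimage, frontier_eq_closure_inter_closure, mem_inter_iff, not_and_or] at hfr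
    rw [frontier_eq_closure_inter_closure, mem_inter_iff, not_and_or]
    rcases hfr with h | h
    · left
      rw [← mem_compl_iff, ← interior_compl, mem_interior_iff_mem_nhds] at h ⊢
      filter_upwards [hcont h] with u hu hu'
      exact hu hu'.2
    · right
      rw [← mem_compl_iff, ← interior_compl, compl_compl, mem_interior_iff_mem_nhds] at h ⊢
      filter_upwards [hcont h, hnhds] with u hu hu'
      exact ⟨Ioo_subset_Icc_self hu', hu⟩
  exact hfr' ht

theorem volume_gPreimage_le {s : ℝ} (hs : 1 < s) {A : Set ℝ} (hA : volume (frontier A) = 0) :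
    volume.real (gPreimage s A) ≤ volume.real (Ioo 0 1 ∩ g s ⁻¹' interior A) := by
  have hsub : gPreimage s A ⊆ (Ioo 0 1 ∩ g s ⁻¹' interior A) ∪
      ({0, 1} ∪ (Ioo 0 1 ∩ g s ⁻¹' frontier A)) := by
    intro t ht
    rcases gPreimage_subset s A ht with h | ⟨h, hA⟩
    · exact Or.inr (Or.inl h)
    · by_cases hi : g s t ∈ interior A
      · exact Or.inl ⟨h, hi⟩
      · exact Or.inr (Or.inr ⟨h, subset_closure hA, hi⟩)
  have h1 : volume (gPreimage s A) ≤ volume (Ioo 0 1 ∩ g s ⁻¹' interior A) := by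
    refine (measure_mono hsub).trans ((measure_union_le _ _).trans ?_)
    rw [volume_preimage_frontier hs hA, add_zero]
  exact ENNReal.toReal_mono (measure_ne_top_of_subset (inter_subset_left.trans Ioo_subset_Icc_self)
    (by simp)) h1

theorem one_sub_volume_gPreimage_le {s : ℝ} (hs : 1 < s) {A : Set ℝ}
    (hA : volume (frontier A) = 0) :
    1 - volume.real (gPreimage s A) ≤ volume.real (Ioo 0 1 ∩ g s ⁻¹' (closure A)ᶜ) := by
  have hfin (S : Set ℝ) : volume (Ioo 0 1 ∩ S) ≠ ⊤ :=
    measure_ne_top_of_subset (inter_subset_left.trans Ioo_subset_Icc_self) (by simp)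
  have hfin' : volume (gPreimage s A) ≠ ⊤ :=
    measure_ne_top_of_subset (fun t ht => ht.1 : gPreimage s A ⊆ Icc 0 1) (by simp)
  have hsub : Ioo (0 : ℝ) 1 ⊆ gPreimage s A ∪ (Ioo 0 1 ∩ g s ⁻¹' (closure A)ᶜ) ∪
      ({0, 1} ∪ (Ioo 0 1 ∩ g s ⁻¹' frontier A)) := by
    intro t ht
    by_cases h : g s t ∈ A
    · exact Or.inl (Or.inl ⟨Ioo_subset_Icc_self ht, h⟩)
    by_cases hc : g s t ∈ closure A
    · exact Or.inr (Or.inr ⟨ht, hc, fun hi => h (interior_subset hi)⟩)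
    · exact Or.inl (Or.inr ⟨ht, hc⟩)
  have h1 : (1 : ENNReal) ≤ volume (gPreimage s A) + volume (Ioo 0 1 ∩ g s ⁻¹' (closure A)ᶜ) := by
    have h2 := (measure_mono hsub).trans (measure_union_le (μ := volume) _ _)
    rw [volume_preimage_frontier hs hA, add_zero, Real.volume_Ioo] at h2
    refine le_trans (by simp) (h2.trans (measure_union_le _ _))
  have h3 := ENNReal.toReal_mono (ENNReal.add_ne_top.2 ⟨hfin', hfin _⟩) h1
  rw [ENNReal.toReal_add hfin' (hfin _), ENNReal.toReal_one] at h3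
  simp only [measureReal_def]
  linarith

theorem isOpen_Ioo_inter_preimage_g {s : ℝ} (hs : 1 < s) {O : Set ℝ} (hO : IsOpen O) :
    IsOpen (Ioo 0 1 ∩ g s ⁻¹' O) :=
  (continuousOn_g hs).isOpen_inter_preimage isOpen_Ioo hO

/-- Complements of shrinking thickenings exhaust the complement of the closure, so continuity from
below applies. Of the radius `2 * ε`, one `ε` is for the Minkowski sum in `setIndex` and one for the
distance between the operator and `g s`. -/
theorem exists_lt_volume_compl_cthickening {s : ℝ} {A : Set ℝ} {c : ℝ} (hc0 : 0 ≤ c)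
    (hc : c < volume.real (Ioo 0 1 ∩ g s ⁻¹' (closure A)ᶜ)) :
    ∃ ε > 0, c < volume.real (Ioo 0 1 ∩ g s ⁻¹' (Metric.cthickening (2 * ε) A)ᶜ) := by
  set E : ℕ → Set ℝ := fun k =>
    Ioo 0 1 ∩ g s ⁻¹' (Metric.cthickening (2 * (1 / ((k : ℝ) + 1))) A)ᶜ with hE
  have hfin (S : Set ℝ) : volume (Ioo 0 1 ∩ S) ≠ ⊤ :=
    measure_ne_top_of_subset (inter_subset_left.trans Ioo_subset_Icc_self) (by simp)
  have hmono : Monotone E := fun k l hkl => by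
    refine inter_subset_inter_right _ (preimage_mono (compl_subset_compl.2
      (Metric.cthickening_mono ?_ A)))
    gcongr
  have hunion : Ioo 0 1 ∩ g s ⁻¹' (closure A)ᶜ ⊆ ⋃ k, E k := by
    rintro t ⟨ht, htA⟩
    rw [mem_preimage, mem_compl_iff, Metric.mem_closure_iff] at htA
    push Not at htA
    obtain ⟨η, hη, hA⟩ := htA
    obtain ⟨k, hk⟩ := exists_nat_one_div_lt (show 0 < η / 4 by positivity)
    refine mem_iUnion.2 ⟨k, ht, fun hmem => ?_⟩
    have h1 := Metric.cthickening_subset_thickening' (E := A)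
      (show 0 < η by positivity) (show 2 * (1 / ((k : ℝ) + 1)) < η by linarith) hmem
    obtain ⟨a, ha, hd⟩ := Metric.mem_thickening_iff.1 h1
    exact absurd hd (not_lt.2 (hA a ha))
  have hlim := tendsto_measure_iUnion_atTop (μ := volume) hmono
  have hlt : ENNReal.ofReal c < volume (⋃ k, E k) := by
    refine lt_of_lt_of_le ?_ (measure_mono hunion)
    rwa [ENNReal.ofReal_lt_iff_lt_toReal hc0 (hfin _)]
  obtain ⟨k, hk⟩ := (hlim.eventually_const_lt hlt).exists
  refine ⟨1 / ((k : ℝ) + 1), by positivity, ?_⟩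
  exact (ENNReal.ofReal_lt_iff_lt_toReal hc0 (hfin _)).1 hk

/-! ### Irrational jumps: indices and densities. -/

theorem setIndex_shepard_eq {s : ℝ} (hs : 1 < s) (d : ℝ) {x : ℝ} (hx : x ∈ Ioo (0 : ℝ) 1)
    (hirr : Irrational x) {A : Set ℝ} (hA : volume (frontier A) = 0) :
    setIndex (fun n : ℕ => shepard n s (step x d) x) A = (volume (gPreimage s A)).toReal := by
  rw [← measureReal_def]
  set ρ := volume.real (gPreimage s A) with hρ
  have hclose (ε : ℝ) (hε : 0 < ε) : ∀ᶠ n : ℕ in atTop, Int.fract (n * x) ∈ Ioo (0 : ℝ) 1 ∧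
      |shepard n s (step x d) x - g s (Int.fract (n * x))| ≤ ε := by
    filter_upwards [eventually_abs_shepard_sub_g_le hs d hx hε, eventually_ne_atTop 0] with n h hn
    have h0 := fract_natCast_mul_pos hirr hn
    exact ⟨⟨h0, Int.fract_lt_one _⟩, h h0.ne'⟩
  unfold setIndex
  rw [iSup_pos_eq (c := 1 - ρ)]
  · ring
  · rintro ⟨ε, hε⟩
    refine upperDensity_le fun η hη => ?_
    set U := Ioo 0 1 ∩ g s ⁻¹' interior A with hU
    have h1 : ∀ᶠ n : ℕ in atTop, n ∈ {n : ℕ | shepard n s (step x d) x ∉ A + Ioo (-ε) ε} →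
        n ∈ {n : ℕ | Int.fract (n * x) ∈ U}ᶜ := by
      filter_upwards [hclose (ε / 2) (half_pos hε)] with n hn hn' (hnU : Int.fract (n * x) ∈ U)
      refine hn' (mem_add.2 ⟨_, interior_subset hnU.2, _, ?_, add_sub_cancel _ _⟩)
      have := abs_le.1 hn.2
      exact ⟨by linarith, by linarith⟩
    have hUlt : ρ - η / 2 < volume.real U := by linarith [volume_gPreimage_le hs hA]
    filter_upwards [proportion_le_add_of_eventually h1 (half_pos hη),
      eventually_lt_proportion_fract hirr (isOpen_Ioo_inter_preimage_g hs isOpen_interior)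
        inter_subset_left hUlt, eventually_ne_atTop 0] with N h2 h3 hN
    rw [proportion_compl _ hN] at h2
    linarith
  · intro η hη
    -- A negative bound is trivial, and the exhaustion lemma needs a nonnegative one.
    rcases lt_or_ge (1 - ρ - η / 2) 0 with hneg | hpos
    · exact ⟨⟨1, one_pos⟩, le_upperDensity (Eventually.of_forall fun N => by
        linarith [proportion_nonneg {n : ℕ | shepard n s (step x d) x ∉
          A + Ioo (-((⟨1, one_pos⟩ : {ε : ℝ // 0 < ε}) : ℝ)) ((⟨1, one_pos⟩ : {ε : ℝ // 0 < ε}) : ℝ)} N])⟩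
    obtain ⟨ε, hε, hlt⟩ := exists_lt_volume_compl_cthickening hpos
      (by linarith [one_sub_volume_gPreimage_le hs hA] :
        1 - ρ - η / 2 < volume.real (Ioo 0 1 ∩ g s ⁻¹' (closure A)ᶜ))
    refine ⟨⟨ε, hε⟩, le_upperDensity ?_⟩
    set U := Ioo 0 1 ∩ g s ⁻¹' (Metric.cthickening (2 * ε) A)ᶜ with hU
    have h1 : ∀ᶠ n : ℕ in atTop, n ∈ {n : ℕ | Int.fract (n * x) ∈ U} →
        n ∈ {n : ℕ | shepard n s (step x d) x ∉ A + Ioo (-ε) ε} := by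
      filter_upwards [hclose ε hε] with n hn (hnU : Int.fract (n * x) ∈ U) hmem
      obtain ⟨a, ha, e, he, hae⟩ := mem_add.1 hmem
      refine hnU.2 (Metric.mem_cthickening_of_dist_le _ a _ _ ha ?_)
      have := abs_le.1 hn.2
      change a + e = shepard n s (step x d) x at hae
      rw [← hae] at this
      rw [Real.dist_eq, abs_le]
      constructor <;> linarith [he.1, he.2]
    filter_upwards [proportion_le_add_of_eventually h1 (half_pos hη),
      eventually_lt_proportion_fract hirr
        (isOpen_Ioo_inter_preimage_g hs Metric.isClosed_cthickening.isOpen_compl)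
        inter_subset_left hlt] with N h2 h3
    linarith

theorem tendsto_proportion_abs_shepard_sub_half (d : ℝ) {x : ℝ} (hx : x ∈ Ioo (0 : ℝ) 1)
    (hirr : Irrational x) {ε : ℝ} (hε : 0 < ε) :
    Tendsto (proportion {n : ℕ | ε ≤ |shepard n 1 (step x d) x - 1 / 2|}) atTop (𝓝 0) := by
  rw [Metric.tendsto_atTop']
  intro η' hη'
  -- The bound `η < 1` keeps `(δ, 1 - δ)` nondegenerate for `δ = η / 8`; the final estimate is `3 *
  -- δ + η / 2 < η'`.
  obtain ⟨η, hη, hη1, hηη⟩ : ∃ η > 0, η < 1 ∧ η ≤ η' / 2 :=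
    ⟨min (1 / 2) (η' / 2), by positivity, by linarith [min_le_left (1 / 2) (η' / 2)],
      min_le_right _ _⟩
  set δ := η / 8 with hδ
  have hδ0 : 0 < δ := by positivity
  have h1 : ∀ᶠ n : ℕ in atTop, n ∈ {n : ℕ | ε ≤ |shepard n 1 (step x d) x - 1 / 2|} →
      n ∈ {n : ℕ | Int.fract (n * x) ∈ Ioo δ (1 - δ)}ᶜ := by
    filter_upwards [eventually_abs_shepard_sub_half_lt d hx hδ0 hε] with n hn hn' hU
    exact absurd (hn (Ioo_subset_Icc_self hU)) (not_lt.2 hn')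
  have hvol : 1 - 3 * δ < volume.real (Ioo δ (1 - δ)) := by
    rw [Real.volume_real_Ioo_of_le (by linarith)]
    linarith
  have hev : ∀ᶠ N in atTop,
      dist (proportion {n : ℕ | ε ≤ |shepard n 1 (step x d) x - 1 / 2|} N) 0 < η' := by
    filter_upwards [proportion_le_add_of_eventually h1 (half_pos hη),
      eventually_lt_proportion_fract hirr isOpen_Ioo (Ioo_subset_Ioo hδ0.le (by linarith)) hvol,
      eventually_ne_atTop 0] with N h2 h3 hN
    rw [proportion_compl _ hN] at h2
    rw [Real.dist_0_eq_abs, abs_of_nonneg (proportion_nonneg _ _)]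
    linarith
  obtain ⟨N, hN⟩ := eventually_atTop.1 hev
  exact ⟨N, fun n hn => hN n hn.le⟩

theorem index_shepard_half_eq_one (d : ℝ) {x : ℝ} (hx : x ∈ Ioo (0 : ℝ) 1)
    (hirr : Irrational x) : index (fun n : ℕ => shepard n 1 (step x d) x) (1 / 2) = 1 := by
  have h (ε : {ε : ℝ // 0 < ε}) :
      upperDensity {n : ℕ | (ε : ℝ) ≤ |shepard n 1 (step x d) x - 1 / 2|} = 0 :=
    (tendsto_proportion_abs_shepard_sub_half d hx hirr ε.2).limsup_eq
  unfold index
  simp only [mem_Iic_union_Ici_iff, h]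
  simp

/-- From some index on, the subsequence stays a fixed distance away from `1 / 2`, and the set of all
such `n` has density zero. -/
theorem hasDensity_range_of_tendsto (d : ℝ) {x : ℝ} (hx : x ∈ Ioo (0 : ℝ) 1)
    (hirr : Irrational x) {L : ℝ} (hL : L ≠ 1 / 2) {k : ℕ → ℕ} (hk : StrictMono k)
    (hlim : Tendsto (fun j => shepard (k j) 1 (step x d) x) atTop (𝓝 L)) :
    HasDensity (range k) 0 := by
  have hε : 0 < |L - 1 / 2| / 2 := half_pos (abs_pos.2 (sub_ne_zero.2 hL))
  set ε := |L - 1 / 2| / 2 with hεdef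
  obtain ⟨J, hJ⟩ := Metric.tendsto_atTop.1 hlim ε hε
  have h1 : ∀ᶠ n : ℕ in atTop, n ∈ range k → n ∈ {n | ε ≤ |shepard n 1 (step x d) x - 1 / 2|} := by
    filter_upwards [eventually_ge_atTop (k J)] with n hn
    rintro ⟨j, rfl⟩
    have h2 := hJ j (hk.le_iff_le.1 hn)
    rw [Real.dist_eq, abs_sub_comm] at h2
    have h3 := abs_sub_le L (shepard (k j) 1 (step x d) x) (1 / 2)
    change ε ≤ |shepard (k j) 1 (step x d) x - 1 / 2|
    linarith
  refine hasDensity_of_tendsto (tendsto_order.2 ⟨fun a ha =>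
    Eventually.of_forall fun N => ha.trans_le (proportion_nonneg _ _), fun a ha => ?_⟩)
  filter_upwards [proportion_le_add_of_eventually h1 (half_pos ha),
    (tendsto_proportion_abs_shepard_sub_half d hx hirr hε).eventually_lt_const (half_pos ha)]
    with N h2 h3
  linarith

/-! ### Irrational jumps with `s = 1`: exceptional subsequences. -/

/-- The bound is the quotient of the smaller sum, at most `3 + log n`, by the total, at least `n`.
-/
theorem exists_strictMono_tendsto_of_bound {u : ℕ → ℝ} {L : ℝ}
    (h : ∀ M : ℕ, ∃ n > M, |u n - L| ≤ (3 + Real.log n) / n) :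
    ∃ k : ℕ → ℕ, StrictMono k ∧ Tendsto (fun j => u (k j)) atTop (𝓝 L) := by
  obtain ⟨k, hk, hb⟩ := extraction_of_frequently_atTop (frequently_atTop'.2 h)
  refine ⟨k, hk, ?_⟩
  have hlim : Tendsto (fun n : ℕ => (3 + Real.log n) / n) atTop (𝓝 0) := by
    have h1 := (tendsto_const_div_atTop_nhds_zero_nat (3 : ℝ)).add
      (Real.isLittleO_log_id_atTop.tendsto_div_nhds_zero.comp tendsto_natCast_atTop_atTop)
    rw [add_zero] at h1
    exact h1.congr fun n => by simp [add_div]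
  rw [tendsto_iff_norm_sub_tendsto_zero]
  exact squeeze_zero (fun _ => norm_nonneg _) hb (hlim.comp hk.tendsto_atTop)

/-- Bounds for the partial sums at an integer `n` with `n * x` just above an integer. -/
theorem hurwitzPartial_bounds_of_fract_lt {n N M : ℕ} (hn : 2 ≤ n) {t : ℝ} (ht0 : 0 < t)
    (ht : t < 1 / n) (hN : 0 < N) (hM : M ≤ n + 1) :
    (n : ℝ) ≤ hurwitzPartial 1 t N ∧ hurwitzPartial 1 (1 - t) M ≤ 3 + Real.log n := by
  have hn2 : (2 : ℝ) ≤ n := by exact_mod_cast hn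
  have hn0 : (0 : ℝ) < n := by linarith
  constructor
  · refine le_trans ?_ (one_div_rpow_le_hurwitzPartial 1 ht0.le hN)
    rw [Real.rpow_one, le_one_div hn0 ht0]
    exact ht.le
  · have h2 : (1 : ℝ) / n ≤ 1 / 2 := one_div_le_one_div_of_le two_pos hn2
    have h3 : 1 / (1 - t) ≤ 2 := by
      rw [div_le_iff₀ (by linarith)]
      linarith
    linarith [hurwitzPartial_one_le (show 0 < 1 - t by linarith) hM]

theorem exists_subseq_tendsto_one (d : ℝ) {x : ℝ} (hx : x ∈ Ioo (0 : ℝ) 1) (hirr : Irrational x) :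
    ∃ k : ℕ → ℕ, StrictMono k ∧
      Tendsto (fun j => shepard (k j) 1 (step x d) x) atTop (𝓝 1) := by
  refine exists_strictMono_tendsto_of_bound (u := fun n => shepard n 1 (step x d) x) fun M => ?_
  obtain ⟨n, hn, hf⟩ := exists_gt_fract_lt hirr (M + 1)
  have hn0 : (0 : ℝ) < n := by exact_mod_cast (by omega)
  have hf0 := fract_natCast_mul_pos hirr (show n ≠ 0 by omega)
  refine ⟨n, by omega, ?_⟩
  rw [shepard_step_eq (by omega) 1 d ⟨hx.1.le, hx.2.le⟩ hf0.ne']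
  obtain ⟨hA, hB⟩ := hurwitzPartial_bounds_of_fract_lt (by omega) hf0 hf
    (Nat.succ_pos ⌊n * x⌋₊) (show n - ⌊n * x⌋₊ ≤ n + 1 by omega)
  have hB0 := hurwitzPartial_nonneg 1 (sub_pos.2 (Int.fract_lt_one (n * x))).le (n - ⌊n * x⌋₊)
  set A := hurwitzPartial 1 (Int.fract (n * x)) (⌊n * x⌋₊ + 1)
  set B := hurwitzPartial 1 (1 - Int.fract (n * x)) (n - ⌊n * x⌋₊)
  have hAB : 0 < A + B := by linarith
  rw [div_sub_one hAB.ne', abs_div, abs_of_pos hAB, sub_add_cancel_left, abs_neg, abs_of_nonneg hB0]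
  gcongr
  linarith

theorem exists_subseq_tendsto_zero (d : ℝ) {x : ℝ} (hx : x ∈ Ioo (0 : ℝ) 1) (hirr : Irrational x) :
    ∃ k : ℕ → ℕ, StrictMono k ∧
      Tendsto (fun j => shepard (k j) 1 (step x d) x) atTop (𝓝 0) := by
  refine exists_strictMono_tendsto_of_bound (u := fun n => shepard n 1 (step x d) x) fun M => ?_
  -- Approximating `-x` from the same side makes `1 - Int.fract (n * x)` small, so the nearest right
  -- node dominates.
  obtain ⟨n, hn, hf⟩ := exists_gt_fract_lt hirr.neg (M + 1)
  have hn0 : (0 : ℝ) < n := by exact_mod_cast (by omega)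
  have hf0 := fract_natCast_mul_pos hirr (show n ≠ 0 by omega)
  have hf1 : 0 < 1 - Int.fract (n * x) := sub_pos.2 (Int.fract_lt_one _)
  rw [mul_neg, Int.fract_neg hf0.ne'] at hf
  refine ⟨n, by omega, ?_⟩
  rw [shepard_step_eq (by omega) 1 d ⟨hx.1.le, hx.2.le⟩ hf0.ne']
  have hm := floor_lt_of_fract_ne_zero ⟨hx.1.le, hx.2.le⟩ hf0.ne'
  obtain ⟨hB, hA⟩ := hurwitzPartial_bounds_of_fract_lt (by omega) hf1 hf
    (show 0 < n - ⌊n * x⌋₊ by omega) (show ⌊n * x⌋₊ + 1 ≤ n + 1 by omega)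
  rw [sub_sub_cancel] at hA
  have hA0 := hurwitzPartial_nonneg 1 hf0.le (⌊n * x⌋₊ + 1)
  set A := hurwitzPartial 1 (Int.fract (n * x)) (⌊n * x⌋₊ + 1)
  set B := hurwitzPartial 1 (1 - Int.fract (n * x)) (n - ⌊n * x⌋₊)
  have hAB : 0 < A + B := by linarith
  rw [sub_zero, abs_div, abs_of_pos hAB, abs_of_nonneg hA0]
  gcongr
  linarith

/-! ### Rational jumps. -/

theorem fract_natCast_mul_div (n p q : ℕ) :
    Int.fract ((n : ℝ) * (p / q)) = ((n * p % q : ℕ) : ℝ) / q := by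
  rw [← mul_div_assoc, ← Nat.cast_mul]
  exact Int.fract_div_natCast_eq_div_natCast_mod

/-- At a rational jump `p / q`, the index of convergence of the Shepard operators is the density of
the residue classes on which the limit `v` takes the given value. -/
theorem index_shepard_rational {s d : ℝ} {p q : ℕ} (hq : q ≠ 0)
    (hx : (p : ℝ) / q ∈ Icc (0 : ℝ) 1) {v : ℕ → ℝ} (hv0 : v 0 = d)
    (hv : (p : ℝ) / q ∈ Ioo (0 : ℝ) 1 → ∀ ε > 0, ∀ᶠ n : ℕ in atTop, n * p % q ≠ 0 →
      |shepard n s (step ((p : ℝ) / q) d) ((p : ℝ) / q) - v (n * p % q)| < ε)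
    {L ρ : ℝ} (hρ : Tendsto (proportion {n | v (n * p % q) = L}) atTop (𝓝 ρ)) :
    index (fun n : ℕ => shepard n s (step ((p : ℝ) / q) d) ((p : ℝ) / q)) L = ρ := by
  have hqpos : 0 < q := Nat.pos_of_ne_zero hq
  have hq0 : (0 : ℝ) < q := by exact_mod_cast hqpos
  refine index_eq_of_finite_values (V := v '' Iio q) ((finite_Iio q).image v)
    (fun n => mem_image_of_mem v (Nat.mod_lt _ hqpos)) ?_ hρ
  rw [Metric.tendsto_nhds]
  intro ε hε
  have hzero {n : ℕ} (hn : n ≠ 0) (h : n * p % q = 0) :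
      shepard n s (step ((p : ℝ) / q) d) ((p : ℝ) / q) = v (n * p % q) := by
    rw [shepard_eq_of_fract_eq_zero hn s _ hx (by rw [fract_natCast_mul_div, h]; simp), h, hv0]
    simp [step]
  simp only [Real.dist_0_eq_abs]
  by_cases hxI : (p : ℝ) / q ∈ Ioo (0 : ℝ) 1
  · filter_upwards [hv hxI ε hε, eventually_ne_atTop 0] with n h1 hn
    by_cases h : n * p % q = 0
    · rwa [hzero hn h, sub_self, abs_zero]
    · exact h1 h
  -- A jump at `0` or `1` is a node for every `n ≥ 1`, so only the residue `0` occurs.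
  · filter_upwards [eventually_ne_atTop 0] with n hn
    have h : n * p % q = 0 := by
      rcases hx.1.eq_or_lt with h0 | h0
      · have hp : p = 0 := by
          have := (div_eq_zero_iff.1 h0.symm).resolve_right hq0.ne'
          exact_mod_cast this
        simp [hp]
      rcases hx.2.eq_or_lt with h1 | h1
      · have hp : p = q := by
          rw [div_eq_one_iff_eq hq0.ne'] at h1
          exact_mod_cast h1
        simp [hp]
      · exact absurd ⟨h0, h1⟩ hxI
    rwa [hzero hn h, sub_self, abs_zero]

theorem index_shepard_rational_of_one_lt {s d : ℝ} (hs : 1 < s) {p q : ℕ} (hq : q ≠ 0)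
    (hx : (p : ℝ) / q ∈ Icc (0 : ℝ) 1) {L ρ : ℝ}
    (hρ : Tendsto (proportion {n | (if n * p % q = 0 then d else g s ((n * p % q : ℕ) / q)) = L})
      atTop (𝓝 ρ)) :
    index (fun n : ℕ => shepard n s (step ((p : ℝ) / q) d) ((p : ℝ) / q)) L = ρ := by
  refine index_shepard_rational hq hx (v := fun r => if r = 0 then d else g s ((r : ℝ) / q))
    (if_pos rfl) (fun hxI ε hε => ?_) hρ
  have hq0 : (q : ℝ) ≠ 0 := by exact_mod_cast hq
  filter_upwards [eventually_abs_shepard_sub_g_le hs d hxI (half_pos hε)] with n hn hmod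
  rw [fract_natCast_mul_div] at hn
  rw [if_neg hmod]
  exact (hn (div_ne_zero (by exact_mod_cast hmod) hq0)).trans_lt (half_lt_self hε)

theorem index_shepard_rational_of_eq_one {d : ℝ} {p q : ℕ} (hq : q ≠ 0)
    (hx : (p : ℝ) / q ∈ Icc (0 : ℝ) 1) {L ρ : ℝ}
    (hρ : Tendsto (proportion {n | (if n * p % q = 0 then d else 1 / 2) = L}) atTop (𝓝 ρ)) :
    index (fun n : ℕ => shepard n 1 (step ((p : ℝ) / q) d) ((p : ℝ) / q)) L = ρ := by
  refine index_shepard_rational hq hx (v := fun r => if r = 0 then d else 1 / 2)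
    (if_pos rfl) (fun hxI ε hε => ?_) hρ
  have hqpos : 0 < q := Nat.pos_of_ne_zero hq
  have hq0 : (0 : ℝ) < q := by exact_mod_cast hqpos
  filter_upwards [eventually_abs_shepard_sub_half_lt d hxI (one_div_pos.2 hq0) hε] with n hn hmod
  rw [fract_natCast_mul_div] at hn
  rw [if_neg hmod]
  refine hn ⟨?_, ?_⟩
  · gcongr
    exact_mod_cast Nat.one_le_iff_ne_zero.2 hmod
  · rw [le_sub_iff_add_le, ← add_div, div_le_one hq0]
    exact_mod_cast Nat.mod_lt _ hqpos

theorem div_mem_Ioo_of_lt {m q : ℕ} (hm : m ≠ 0) (hmq : m < q) :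
    (m : ℝ) / q ∈ Ioo (0 : ℝ) 1 := by
  have hm0 : (0 : ℝ) < m := by exact_mod_cast Nat.pos_of_ne_zero hm
  have hmq' : (m : ℝ) < q := by exact_mod_cast hmq
  exact ⟨div_pos hm0 (hm0.trans hmq'), (div_lt_one (hm0.trans hmq')).2 hmq'⟩

theorem g_div_eq_iff {s : ℝ} (hs : 1 < s) {m r q : ℕ} (hm : m ≠ 0) (hmq : m < q) (hr : r ≠ 0)
    (hrq : r < q) : g s ((r : ℝ) / q) = g s ((m : ℝ) / q) ↔ r = m := by
  have hq0 : (q : ℝ) ≠ 0 := by exact_mod_cast (by omega)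
  rw [(strictAntiOn_g hs).injOn.eq_iff (div_mem_Ioo_of_lt hr hrq) (div_mem_Ioo_of_lt hm hmq),
    div_left_inj' hq0, Nat.cast_inj]

end ShepardIndex

open ShepardIndex
-- Assembly of the theorem.
theorem theorem3p1 (s x₀ d : ℝ) (hs : 1 ≤ s) (hx₀ : x₀ ∈ Set.Icc (0 : ℝ) 1) :
    -- uniform convergence on compact sets away from the jump
    (∀ K : Set ℝ, IsCompact K → K ⊆ Set.Icc (0 : ℝ) 1 \ {x₀} →
      TendstoUniformlyOn (fun n : ℕ => shepard n s (step x₀ d)) (step x₀ d) atTop K) ∧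
    -- rational jump
    (∀ p q : ℕ, q ≠ 0 → Nat.Coprime p q → x₀ = (p : ℝ) / (q : ℝ) →
      (1 < s →
        ((∀ m ∈ Finset.Icc 1 (q - 1), d ≠ g s ((m : ℝ) / (q : ℝ))) →
          index (fun n : ℕ => shepard n s (step x₀ d) x₀) d = 1 / (q : ℝ)) ∧
        (∀ m ∈ Finset.Icc 1 (q - 1), d ≠ g s ((m : ℝ) / (q : ℝ)) →
          index (fun n : ℕ => shepard n s (step x₀ d) x₀) (g s ((m : ℝ) / (q : ℝ)))
            = 1 / (q : ℝ))) ∧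
      (s = 1 →
        ((d ≠ 1 / 2 ∨ q = 1) →
          index (fun n : ℕ => shepard n s (step x₀ d) x₀) d = 1 / (q : ℝ)) ∧
        (d ≠ 1 / 2 →
          index (fun n : ℕ => shepard n s (step x₀ d) x₀) (1 / 2) = 1 - 1 / (q : ℝ)))) ∧
    -- irrational jump
    (Irrational x₀ →
      (1 < s → ∀ A : Set ℝ, IsJordanMeasurable A →
        IsJordanMeasurable (gPreimage s A) ∧
        setIndex (fun n : ℕ => shepard n s (step x₀ d) x₀) A
          = (volume (gPreimage s A)).toReal) ∧
      (s = 1 →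
        index (fun n : ℕ => shepard n s (step x₀ d) x₀) (1 / 2) = 1 ∧
        (∀ L : ℝ, L = 0 ∨ L = 1 →
          (∃ k : ℕ → ℕ, StrictMono k ∧
            Tendsto (fun j : ℕ => shepard (k j) s (step x₀ d) x₀) atTop (𝓝 L)) ∧
          (∀ k : ℕ → ℕ, StrictMono k →
            Tendsto (fun j : ℕ => shepard (k j) s (step x₀ d) x₀) atTop (𝓝 L) → HasDensity (Set.range k) 0)))) := by
  refine ⟨fun K hK hKx => tendstoUniformlyOn_shepard_step d hs hK hKx, ?_, ?_⟩
  · rintro p q hq hpq rfl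
    have hqpos : 0 < q := Nat.pos_of_ne_zero hq
    have hdens {m : ℕ} (hm : m < q) := tendsto_proportion_mul_mod hpq hm
    refine ⟨fun hs1 => ⟨fun hd => ?_, fun m hm hd => ?_⟩, ?_⟩
    · refine index_shepard_rational_of_one_lt hs1 hq hx₀ ?_
      convert hdens hqpos using 3
      ext n
      have hlt : n * p % q < q := Nat.mod_lt _ hqpos
      by_cases h : n * p % q = 0
      · simp [h]
      · have := hd (n * p % q) (Finset.mem_Icc.2 ⟨by omega, by omega⟩)
        simp [h, this.symm]
    · rw [Finset.mem_Icc] at hm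
      refine index_shepard_rational_of_one_lt hs1 hq hx₀ ?_
      convert hdens (show m < q by omega) using 3
      ext n
      have hlt : n * p % q < q := Nat.mod_lt _ hqpos
      by_cases h : n * p % q = 0
      -- The class of `0` carries the value `d`, which differs from the target, and `m ≥ 1` keeps it
      -- apart from the class of `m`.
      · simp [h, hd]
        omega
      · simp only [h, if_false]
        exact g_div_eq_iff hs1 (by omega) (by omega) h hlt
    · rintro rfl
      refine ⟨fun hd => ?_, fun hd => ?_⟩
      · refine index_shepard_rational_of_eq_one hq hx₀ ?_
        convert hdens hqpos using 3
        ext n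
        by_cases h : n * p % q = 0
        · simp [h]
        · rcases hd with hd | rfl
          · simp only [h, if_false]
            exact iff_of_false hd.symm id
          · exact absurd (Nat.mod_one _) h
      · refine index_shepard_rational_of_eq_one hq hx₀ ?_
        convert tendsto_proportion_compl (hdens hqpos) using 3
        ext n
        change (if n * p % q = 0 then d else 1 / 2) = 1 / 2 ↔ ¬ n * p % q = 0
        split_ifs with h
        · exact iff_of_false hd fun h' => h' h
        · exact iff_of_true rfl h
  · intro hirr
    have hx : x₀ ∈ Ioo (0 : ℝ) 1 :=
      ⟨lt_of_le_of_ne hx₀.1 hirr.ne_zero.symm, lt_of_le_of_ne hx₀.2 hirr.ne_one⟩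
    refine ⟨fun hs1 A hA => ⟨isJordanMeasurable_gPreimage hs1 hA.2,
      setIndex_shepard_eq hs1 d hx hirr hA.2⟩, ?_⟩
    rintro rfl
    refine ⟨index_shepard_half_eq_one d hx hirr, ?_⟩
    rintro L (rfl | rfl)
    · exact ⟨exists_subseq_tendsto_zero d hx hirr,
        fun k hk => hasDensity_range_of_tendsto d hx hirr (by norm_num) hk⟩
    · exact ⟨exists_subseq_tendsto_one d hx hirr,
        fun k hk => hasDensity_range_of_tendsto d hx hirr (by norm_num) hk⟩
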